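/- **Setting.** A statistical structure on a Riemannian manifold $(\hat M,g)$ is a pair of smooth torsion-free affine connections $\hat\nabla,\hat\nabla^*$ with $(\hat\nabla_Xg)(Y,Z)=(\hat\nabla_Yg)(X,Z)$ and $Xg(Y,Z)=g(\hat\nabla_XY,Z)+g(Y,\hat\nabla^*_XZ)$; then $\hat\nabla^\circ=\frac12(\hat\nabla+\hat\nabla^*)$ is the Levi-Civita connection. An almost quaternion structure is a rank-3 subbundle $\Lambda\subset\mathrm{End}(T\hat M)$ with local canonical bases $J_1,J_2,J_3$, i.e. $J_\alpha^2=-I$, $J_\alpha J_{\alpha+1}=-J_{\alpha+1}J_\alpha=J_{\alpha+2}$ (indices mod 3). A $4m$-dimensional $\hat M$ with such structures is called a quaternion Kaehler-like statistical manifold (with real constant $c$) if for each local canonical basis there are local 1-forms $\omega_\alpha$ with $(\hat\nabla_XJ_\alpha)Y=\omega_{\alpha+2}(X)J_{\alpha+1}Y-\omega_{\alpha+1}(X)J_{\alpha+2}Y$, and the curvature tensor of $\hat\nabla$ is $$\hat R(X,Y)Z=\tfrac c4\Big\{g(Y,Z)X-g(X,Z)Y+\sum_{\alpha=1}^3\big[g(Z,J_\alpha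 Y)J_\alpha X-g(Z,J_\alpha X)J_\alpha Y\big]+\sum_{\alpha=1}^3\big[g(X,J_\alpha Y)-g(J_\alpha X,Y)\big]J_\alpha Z\Big\}.$$ Let $M$ be an $n$-dimensional statistical submanifold, $n\ge2$, i.e. an isometrically immersed manifold with the induced structure $(\nabla,\nabla^*)$, where $\hat\nabla_XY=\nabla_XY+\sigma(X,Y)$ and $\hat\nabla^*_XY=\nabla^*_XY+\sigma^*(X,Y)$ are the decompositions into tangential and normal parts. Let $p\in M$, let $e_1,\dots,e_n$ and $e_{n+1},\dots,e_{4m}$ be orthonormal bases of $T_pM$ and $T_p^\perp M$, let $\pi$ be the plane spanned by $e_1,e_2$, and let $J_1,J_2,J_3$ be a canonical basis near $p$. Put $\sigma^\gamma_{ij}=g(\sigma(e_i,e_j),e_\gamma)$, $\sigma^{*\gamma}_{ij}=g(\sigma^*(e_i,e_j),e_\gamma)$, $H=\frac1n\sum_i\sigma(e_i,e_i)$, $H^*=\frac1n\sum_i\sigma^*(e_i,e_i)$. Let $R,R^*,R^\circ$ be the curvature tensors of $\nabla,\nabla^*,\nabla^\circ=\frac12(\nabla+\nabla^*)$. For orthonormal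 $X,Y\in T_pM$ put $K_\circ(X\wedge Y)=g(R^\circ(X,Y)Y,X)$ and $$K(X\wedge Y)=\tfrac12\big[g(R(X,Y)Y,X)+g(R^*(X,Y)Y,X)-2g(R^\circ(X,Y)Y,X)\big],$$ and let $\tau=\sum_{i<j\le n}K(e_i\wedge e_j)$, $\tau_\circ=\sum_{i<j\le n}K_\circ(e_i\wedge e_j)$, $\hat\tau_\circ=\sum_{i<j\le n}\hat K_\circ(e_i\wedge e_j)$, where $\hat K_\circ$ is the sectional curvature of $\hat\nabla^\circ$. Let $P_\alpha X$ be the tangential component of $J_\alpha X$ for $X\in T_pM$, and $\|P_\alpha\|^2=\sum_i\|P_\alpha e_i\|^2$. The submanifold $M$ is called holomorphic if $J(TM)\subset TM$, and real if $J(TM)\subset T^\perp M$, for all $J\in\Lambda$. **Theorem.** (a) If $M$ is holomorphic, then $$\begin{aligned}(\tau-\tau_\circ)-(K(\pi)-K_\circ(\pi))\ \ge\ &\tfrac c8(n-2)(n+1)+\tfrac c4\sum_{\alpha=1}^3\Big\{\tfrac12(\operatorname{tr}P_\alpha)^2+\tfrac12\|P_\alpha\|^2-\operatorname{tr}(P_\alpha^2)\Big\}\\&-\tfrac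 c4\sum_{\alpha=1}^3\Big\{\tfrac12g^2(e_1,J_\alpha e_2)+\tfrac12g^2(J_\alpha e_1,e_2)+g(e_1,J_\alpha e_1)g(e_2,J_\alpha e_2)-2g(e_1,J_\alpha e_2)g(e_2,J_\alpha e_1)\Big\}\\&-\tfrac{n^2(n-2)}{4(n-1)}\big[\|H\|^2+\|H^*\|^2\big]+2\hat K_\circ(\pi)-2\hat\tau_\circ.\end{aligned}$$ (b) If $M$ is real, then $$(\tau-\tau_\circ)-(K(\pi)-K_\circ(\pi))\ \ge\ \tfrac c8(n-2)(n+1)-\tfrac{n^2(n-2)}{4(n-1)}\big[\|H\|^2+\|H^*\|^2\big]+2\hat K_\circ(\pi)-2\hat\tau_\circ.$$ In each case equality holds if and only if for every $\gamma\in\{n+1,\dots,4m\}$: $\sigma^\gamma_{11}+\sigma^\gamma_{22}=\sigma^\gamma_{33}=\dots=\sigma^\gamma_{nn}$, $\sigma^{*\gamma}_{11}+\sigma^{*\gamma}_{22}=\sigma^{*\gamma}_{33}=\dots=\sigma^{*\gamma}_{nn}$, and $\sigma^\gamma_{ij}=\sigma^{*\gamma}_{ij}=0$ for all $i\ne j$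 with $\{i,j\}\ne\{1,2\}$. -/

import Mathlib

open Bundle FiberBundle VectorField
open scoped Manifold ContDiff Topology

noncomputable section

namespace QuaternionStatistical

section Connections

variable {E : Type*} [NormedAddCommGroup E] [NormedSpace ℝ E] [FiniteDimensional ℝ E]
  {M : Type*} [TopologicalSpace M] [ChartedSpace E M] [IsManifold 𝓘(ℝ, E) ∞ M]

/-- The curvature tensor `R(u, v) w` at `x` of an affine connection `∇`, i.e. the value at `x` of
`∇_X ∇_Y Z - ∇_Y ∇_X Z - ∇_{[X, Y]} Z`, computed with the local extensions `X`, `Y`, `Z` of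
`u`, `v`, `w` that have constant components in the chart at `x`.
In Mathlib's convention `cov Z y (X y)` is the value of `∇_X Z` at `y`. -/
def curvature (cov : CovariantDerivative 𝓘(ℝ, E) E (TangentSpace 𝓘(ℝ, E) : M → Type _))
    (x : M) (u v w : TangentSpace 𝓘(ℝ, E) x) : TangentSpace 𝓘(ℝ, E) x :=
  letI X : Π y : M, TangentSpace 𝓘(ℝ, E) y := extend E u
  letI Y : Π y : M, TangentSpace 𝓘(ℝ, E) y := extend E v
  letI Z : Π y : M, TangentSpace 𝓘(ℝ, E) y := extend E w
  cov (fun y ↦ cov Z y (Y y)) x (X x) - cov (fun y ↦ cov Z y (X y)) x (Y x)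
    - cov Z x (mlieBracket 𝓘(ℝ, E) X Y x)

variable (E M) in
/-- A statistical structure on a Riemannian manifold `M`: a pair `∇`, `∇*` of smooth torsion-free
affine connections such that `∇g` is totally symmetric and
`X g(Y, Z) = g(∇_X Y, Z) + g(Y, ∇*_X Z)`. -/
structure StatisticalStructure [RiemannianBundle (fun x : M ↦ TangentSpace 𝓘(ℝ, E) x)]
    [IsContMDiffRiemannianBundle 𝓘(ℝ, E) ∞ E (fun x : M ↦ TangentSpace 𝓘(ℝ, E) x)] where
  /-- the connection `∇` -/
  conn : CovariantDerivative 𝓘(ℝ, E) E (TangentSpace 𝓘(ℝ, E) : M → Type _)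
  /-- the dual connection `∇*` -/
  dual : CovariantDerivative 𝓘(ℝ, E) E (TangentSpace 𝓘(ℝ, E) : M → Type _)
  smooth_conn : CovariantDerivative.ContMDiffCovariantDerivative conn ∞
  smooth_dual : CovariantDerivative.ContMDiffCovariantDerivative dual ∞
  torsion_conn : conn.torsion = 0
  torsion_dual : dual.torsion = 0
  /-- `(∇_u g)(v, w) = (∇_v g)(u, w)` -/
  codazzi : ∀ (x : M) (u v w : TangentSpace 𝓘(ℝ, E) x),
    conn.derivMetricTensor x v w u = conn.derivMetricTensor x u w v
  duality : ∀ (x : M) (Y Z : Π y : M, TangentSpace 𝓘(ℝ, E) y),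
    MDiffAt (T% Y) x → MDiffAt (T% Z) x → ∀ u : TangentSpace 𝓘(ℝ, E) x,
      d% (fun y ↦ inner ℝ (Y y) (Z y)) x u
        = inner ℝ (conn Y x u) (Z x) + inner ℝ (Y x) (dual Z x u)

namespace StatisticalStructure

variable [RiemannianBundle (fun x : M ↦ TangentSpace 𝓘(ℝ, E) x)]
  [IsContMDiffRiemannianBundle 𝓘(ℝ, E) ∞ E (fun x : M ↦ TangentSpace 𝓘(ℝ, E) x)]
  (S : StatisticalStructure E M)

/-- The connection `∇° = (∇ + ∇*) / 2`, see `torsion_leviCivita` and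
`isMetricCompatible_leviCivita`. -/
def leviCivita : CovariantDerivative 𝓘(ℝ, E) E (TangentSpace 𝓘(ℝ, E) : M → Type _) :=
  S.conn.affineCombination S.dual (fun _ ↦ 1 / 2)

lemma leviCivita_apply (Y : Π y : M, TangentSpace 𝓘(ℝ, E) y) (x : M)
    (u : TangentSpace 𝓘(ℝ, E) x) :
    S.leviCivita Y x u = (1 / 2 : ℝ) • S.conn Y x u + (1 / 2 : ℝ) • S.dual Y x u := by
  simp [leviCivita, CovariantDerivative.affineCombination]
  norm_num

lemma torsion_leviCivita : S.leviCivita.torsion = 0 := by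
  rw [CovariantDerivative.torsion_eq_zero_iff]
  intro X Y x hX hY
  have h1 := S.conn.torsion_eq_zero_iff.1 S.torsion_conn hX hY
  have h2 := S.dual.torsion_eq_zero_iff.1 S.torsion_dual hX hY
  rw [leviCivita_apply, leviCivita_apply]
  rw [sub_eq_iff_eq_add] at h1 h2
  rw [h1, h2]
  module

lemma isMetricCompatible_leviCivita : CovariantDerivative.IsMetricCompatible
    (V := fun x : M ↦ TangentSpace 𝓘(ℝ, E) x) S.leviCivita := by
  rw [CovariantDerivative.isMetricCompatible_iff]
  intro x X Y Z _ hY hZ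
  have h1 := S.duality x Y Z hY hZ (X x)
  have h2 := S.duality x Z Y hZ hY (X x)
  have h3 : (fun y ↦ inner ℝ (Z y) (Y y)) = fun y ↦ inner ℝ (Y y) (Z y) := by
    funext y; exact real_inner_comm _ _
  rw [h3] at h2
  have key : d% (fun y ↦ inner ℝ (Y y) (Z y)) x (X x)
      = inner ℝ (S.leviCivita Y x (X x)) (Z x) + inner ℝ (Y x) (S.leviCivita Z x (X x)) := by
    rw [leviCivita_apply, leviCivita_apply, inner_add_left, inner_add_right]
    simp only [real_inner_smul_left, real_inner_smul_right]
    rw [real_inner_comm (Y x), real_inner_comm _ (Z x)] at h2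
    linarith
  exact key

/-- The Riemannian sectional curvature `K°(π) = g(R°(u, v) v, u)` of the plane `π` with
orthonormal basis `u`, `v`. -/
def sectionalLC (x : M) (u v : TangentSpace 𝓘(ℝ, E) x) : ℝ :=
  inner ℝ (curvature S.leviCivita x u v v) u

/-- The sectional `K`-curvature
`K(π) = (g(R(u, v) v, u) + g(R*(u, v) v, u) - 2 g(R°(u, v) v, u)) / 2`
of the plane `π` with orthonormal basis `u`, `v`. -/
def sectionalK (x : M) (u v : TangentSpace 𝓘(ℝ, E) x) : ℝ :=
  (1 / 2) * (inner ℝ (curvature S.conn x u v v) u + inner ℝ (curvature S.dual x u v v) u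
    - 2 * inner ℝ (curvature S.leviCivita x u v v) u)

/-- The sum `∑_{i < j} K(e_i ∧ e_j)` over a finite family of vectors (the scalar curvature for the
sectional `K`-curvature if `e` is an orthonormal basis). -/
def scalarK {n : ℕ} (x : M) (e : Fin n → TangentSpace 𝓘(ℝ, E) x) : ℝ :=
  ∑ i, ∑ j, if i < j then S.sectionalK x (e i) (e j) else 0

/-- The sum `∑_{i < j} K°(e_i ∧ e_j)` over a finite family of vectors (the Riemannian scalar
curvature if `e` is an orthonormal basis). -/
def scalarLC {n : ℕ} (x : M) (e : Fin n → TangentSpace 𝓘(ℝ, E) x) : ℝ :=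
  ∑ i, ∑ j, if i < j then S.sectionalLC x (e i) (e j) else 0

end StatisticalStructure

end Connections

section Quaternionic

variable (E : Type*) [NormedAddCommGroup E] [NormedSpace ℝ E] [FiniteDimensional ℝ E]
  (M : Type*) [TopologicalSpace M] [ChartedSpace E M] [IsManifold 𝓘(ℝ, E) ∞ M]

/-- A smooth local triple `J 0`, `J 1`, `J 2` of fields of endomorphisms on the open set `U`, with
`J_α² = -1` and `J_α J_{α+1} = -J_{α+1} J_α = J_{α+2}` (indices modulo `3`), that spans the
subspaces `Λ y` for `y ∈ U`. -/
structure IsCanonicalBasis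
    (Λ : Π x : M, Submodule ℝ (TangentSpace 𝓘(ℝ, E) x →L[ℝ] TangentSpace 𝓘(ℝ, E) x))
    (U : Set M)
    (J : Fin 3 → Π x : M, TangentSpace 𝓘(ℝ, E) x →L[ℝ] TangentSpace 𝓘(ℝ, E) x) : Prop where
  isOpen : IsOpen U
  smooth : ∀ α, ContMDiffOn 𝓘(ℝ, E) (𝓘(ℝ, E).prod 𝓘(ℝ, E →L[ℝ] E)) ∞
    (fun y ↦ (⟨y, J α y⟩ : TotalSpace (E →L[ℝ] E)
      (fun y : M ↦ TangentSpace 𝓘(ℝ, E) y →L[ℝ] TangentSpace 𝓘(ℝ, E) y))) U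
  sq : ∀ y ∈ U, ∀ α v, J α y (J α y v) = -v
  mul : ∀ y ∈ U, ∀ α v, J α y (J (α + 1) y v) = J (α + 2) y v
  mul_swap : ∀ y ∈ U, ∀ α v, J (α + 1) y (J α y v) = -J (α + 2) y v
  span : ∀ y ∈ U, Λ y = Submodule.span ℝ (Set.range fun α ↦ J α y)

/-- An almost quaternion structure: a subbundle `Λ` of `End(TM)` that is locally spanned by
canonical bases. -/
structure AlmostQuaternionStructure where
  /-- the fibres of the subbundle -/
  Λ : Π x : M, Submodule ℝ (TangentSpace 𝓘(ℝ, E) x →L[ℝ] TangentSpace 𝓘(ℝ, E) x)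
  exists_basis : ∀ x : M, ∃ U, x ∈ U ∧ ∃ J, IsCanonicalBasis E M Λ U J

variable {E M}
  [RiemannianBundle (fun x : M ↦ TangentSpace 𝓘(ℝ, E) x)]
  [IsContMDiffRiemannianBundle 𝓘(ℝ, E) ∞ E (fun x : M ↦ TangentSpace 𝓘(ℝ, E) x)]

/-- A quaternion Kaehler-like statistical manifold with constant `c`: for every local canonical
basis there are local `1`-forms `η` with
`(∇_X J_α) Y = η_{α+2}(X) J_{α+1} Y - η_{α+1}(X) J_{α+2} Y`, and the curvature tensor of `∇` is
`R(X, Y) Z = c/4 (g(Y, Z) X - g(X, Z) Y + ∑_α (g(Z, J_α Y) J_α X - g(Z, J_α X) J_α Y)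
+ ∑_α (g(X, J_α Y) J_α Z - g(J_α X, Y) J_α Z))`. -/
structure IsQuaternionKaehlerLike (S : StatisticalStructure E M)
    (Q : AlmostQuaternionStructure E M) (c : ℝ) : Prop where
  parallel : ∀ U J, IsCanonicalBasis E M Q.Λ U J →
    ∃ η : Fin 3 → Π y : M, TangentSpace 𝓘(ℝ, E) y →L[ℝ] ℝ,
      ∀ y ∈ U, ∀ (α : Fin 3) (Y : Π z : M, TangentSpace 𝓘(ℝ, E) z), MDiffAt (T% Y) y →
        ∀ u : TangentSpace 𝓘(ℝ, E) y,
          S.conn (fun z ↦ J α z (Y z)) y u - J α y (S.conn Y y u)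
            = η (α + 2) y u • J (α + 1) y (Y y) - η (α + 1) y u • J (α + 2) y (Y y)
  curvature_eq : ∀ U J, IsCanonicalBasis E M Q.Λ U J →
    ∀ y ∈ U, ∀ u v w : TangentSpace 𝓘(ℝ, E) y,
      curvature S.conn y u v w = (c / 4) •
        (inner ℝ v w • u - inner ℝ u w • v
          + ∑ α, (inner ℝ w (J α y v) • J α y u - inner ℝ w (J α y u) • J α y v)
          + ∑ α, (inner ℝ u (J α y v) • J α y w - inner ℝ (J α y u) v • J α y w))

end Quaternionic

section Submanifolds

variable {F : Type*} [NormedAddCommGroup F] [NormedSpace ℝ F] [FiniteDimensional ℝ F]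
  {N : Type*} [TopologicalSpace N] [ChartedSpace F N] [IsManifold 𝓘(ℝ, F) ∞ N]
  {E : Type*} [NormedAddCommGroup E] [NormedSpace ℝ E] [FiniteDimensional ℝ E]
  {M : Type*} [TopologicalSpace M] [ChartedSpace E M] [IsManifold 𝓘(ℝ, E) ∞ M]

/-- The derivative at `p`, in the direction `u ∈ T_p N`, of a vector field `V` along a map
`f : N → M` with respect to a connection `∇` on `M`. In the chart at `f p`, with coordinate fields
`∂_i` and `V = ∑ V^i ∂_i`, it is `∑ dV^i(u) ∂_i + ∑ V^i(p) ∇_{df(u)} ∂_i`. -/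
def derivAlong (cov : CovariantDerivative 𝓘(ℝ, E) E (TangentSpace 𝓘(ℝ, E) : M → Type _))
    (f : N → M) (V : Π q : N, TangentSpace 𝓘(ℝ, E) (f q)) (p : N)
    (u : TangentSpace 𝓘(ℝ, F) p) : TangentSpace 𝓘(ℝ, E) (f p) :=
  letI t := trivializationAt E (TangentSpace 𝓘(ℝ, E) : M → Type _) (f p)
  letI components : N → E := fun q ↦ (t ⟨f q, V q⟩).2
  t.symm (f p) (mfderiv 𝓘(ℝ, F) 𝓘(ℝ, E) components p u)
    + cov (extend E (V p)) (f p) (mfderiv 𝓘(ℝ, F) 𝓘(ℝ, E) f p u)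

/-- The derivative `D_u (df Y)` of the image of a vector field `Y` on `N`; for a submanifold this is
`∇_u Y` for the connection of the ambient manifold. -/
def ambientDeriv (cov : CovariantDerivative 𝓘(ℝ, E) E (TangentSpace 𝓘(ℝ, E) : M → Type _))
    (f : N → M) (Y : Π q : N, TangentSpace 𝓘(ℝ, F) q) (p : N)
    (u : TangentSpace 𝓘(ℝ, F) p) : TangentSpace 𝓘(ℝ, E) (f p) :=
  derivAlong cov f (fun q ↦ mfderiv 𝓘(ℝ, F) 𝓘(ℝ, E) f q (Y q)) p u

variable [RiemannianBundle (fun x : N ↦ TangentSpace 𝓘(ℝ, F) x)]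
  [IsContMDiffRiemannianBundle 𝓘(ℝ, F) ∞ F (fun x : N ↦ TangentSpace 𝓘(ℝ, F) x)]
  [RiemannianBundle (fun x : M ↦ TangentSpace 𝓘(ℝ, E) x)]
  [IsContMDiffRiemannianBundle 𝓘(ℝ, E) ∞ E (fun x : M ↦ TangentSpace 𝓘(ℝ, E) x)]

variable (F E) in
/-- The normal space of `f : N → M` at `p`. -/
def normalSpace (f : N → M) (p : N) : Submodule ℝ (TangentSpace 𝓘(ℝ, E) (f p)) :=
  (LinearMap.range (mfderiv 𝓘(ℝ, F) 𝓘(ℝ, E) f p).toLinearMap)ᗮ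

/-- `(N, ∇, ∇*)` is a statistical submanifold of `(M, ∇^, ∇^*)` through `f`: `f` is a smooth
isometric immersion, and `∇_X Y`, `∇*_X Y` are the tangential components of the ambient
derivatives. -/
structure IsStatisticalSubmanifold (f : N → M) (S : StatisticalStructure F N)
    (T : StatisticalStructure E M) : Prop where
  smooth : ContMDiff 𝓘(ℝ, F) 𝓘(ℝ, E) ∞ f
  isometric : ∀ (p : N) (u v : TangentSpace 𝓘(ℝ, F) p),
    inner ℝ (mfderiv 𝓘(ℝ, F) 𝓘(ℝ, E) f p u) (mfderiv 𝓘(ℝ, F) 𝓘(ℝ, E) f p v) = inner ℝ u v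
  tangential_conn : ∀ (p : N) (Y : Π q : N, TangentSpace 𝓘(ℝ, F) q), MDiffAt (T% Y) p →
    ∀ u : TangentSpace 𝓘(ℝ, F) p,
      ambientDeriv T.conn f Y p u - mfderiv 𝓘(ℝ, F) 𝓘(ℝ, E) f p (S.conn Y p u)
        ∈ normalSpace F E f p
  tangential_dual : ∀ (p : N) (Y : Π q : N, TangentSpace 𝓘(ℝ, F) q), MDiffAt (T% Y) p →
    ∀ u : TangentSpace 𝓘(ℝ, F) p,
      ambientDeriv T.dual f Y p u - mfderiv 𝓘(ℝ, F) 𝓘(ℝ, E) f p (S.dual Y p u)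
        ∈ normalSpace F E f p

/-- The second fundamental form of the Gauss formula `∇^_X Y = ∇_X Y + σ(X, Y)`, where `∇^` is the
connection `covM` of the ambient manifold and `∇` is the connection `covN` induced by it. -/
def secondFundamentalForm
    (covN : CovariantDerivative 𝓘(ℝ, F) F (TangentSpace 𝓘(ℝ, F) : N → Type _))
    (covM : CovariantDerivative 𝓘(ℝ, E) E (TangentSpace 𝓘(ℝ, E) : M → Type _))
    (f : N → M) (p : N) (u v : TangentSpace 𝓘(ℝ, F) p) : TangentSpace 𝓘(ℝ, E) (f p) :=
  ambientDeriv covM f (extend F v) p u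
    - mfderiv 𝓘(ℝ, F) 𝓘(ℝ, E) f p (covN (extend F v) p u)

/-- The mean curvature vector `H = (1/n) ∑ σ(e_i, e_i)` of a second fundamental form `σ`. -/
def meanCurvature {n : ℕ} {V W : Type*} [AddCommGroup W] [Module ℝ W] (σ : V → V → W)
    (e : Fin n → V) : W :=
  (1 / n : ℝ) • ∑ i, σ (e i) (e i)

/-- The submanifold is holomorphic: `J (T_p N) ⊆ T_p N` for all `J ∈ Λ`. -/
def IsHolomorphic (f : N → M) (Q : AlmostQuaternionStructure E M) : Prop :=
  ∀ p : N, ∀ J ∈ Q.Λ (f p), ∀ u : TangentSpace 𝓘(ℝ, F) p,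
    J (mfderiv 𝓘(ℝ, F) 𝓘(ℝ, E) f p u)
      ∈ LinearMap.range (mfderiv 𝓘(ℝ, F) 𝓘(ℝ, E) f p).toLinearMap

/-- The submanifold is (totally) real: `J (T_p N) ⊆ T_p^⊥ N` for all `J ∈ Λ`. -/
def IsTotallyReal (f : N → M) (Q : AlmostQuaternionStructure E M) : Prop :=
  ∀ p : N, ∀ J ∈ Q.Λ (f p), ∀ u : TangentSpace 𝓘(ℝ, F) p,
    J (mfderiv 𝓘(ℝ, F) 𝓘(ℝ, E) f p u) ∈ normalSpace F E f p

instance finiteDimensional_tangentSpace (x : M) : FiniteDimensional ℝ (TangentSpace 𝓘(ℝ, E) x) :=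
  inferInstanceAs (FiniteDimensional ℝ E)

/-- The tangential part `P : T_p N → T_p N` of an endomorphism `J` of the ambient tangent space,
i.e. `P u` is the tangential component of `J u`. -/
def tangentialPart (f : N → M) (p : N)
    (J : TangentSpace 𝓘(ℝ, E) (f p) →L[ℝ] TangentSpace 𝓘(ℝ, E) (f p)) :
    TangentSpace 𝓘(ℝ, F) p →ₗ[ℝ] TangentSpace 𝓘(ℝ, F) p :=
  letI d : TangentSpace 𝓘(ℝ, F) p →ₗ[ℝ] TangentSpace 𝓘(ℝ, E) (f p) :=
    (mfderiv 𝓘(ℝ, F) 𝓘(ℝ, E) f p).toLinearMap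
  LinearMap.adjoint d ∘ₗ J.toLinearMap ∘ₗ d

end Submanifolds

end QuaternionStatistical

end

open QuaternionStatistical

/-! The inequality is an identity with two non-negative remainders. By definition `K - K°` is half
the sum of the curvature terms of `∇` and `∇*`, minus twice the Riemannian one. Each of the three is
moved to the ambient manifold by a Gauss equation (`IsTangentialPart.gauss`). Those of `∇` and `∇*`
contain only mixed products of `σ` and `σ*`. The Levi-Civita one contains `(σ + σ*)/2`, and its
mixed products cancel the former exactly. What survives is the ambient curvature and, separately for
`σ` and `σ*`, half of `|σ(u,v)|² - g(σ(u,u), σ(v,v))` (`sectionalK_sub_sectionalLC`). The ambient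
curvature of `∇` is given, that of `∇*` follows by duality (`IsDualPair.curvature`), and that of the
Levi-Civita connection stays in the formula.

Summing over all pairs except the plane `π` turns the `J`-terms into traces of the `P_α`
(`scalarK_sub_scalarLC_sub`). In each normal direction the remainder together with its share of the
mean curvature term splits into squares of off-diagonal entries and Chen's algebraic inequality for
the diagonal (`chen_inequality_symm`). Both are non-negative with explicit equality cases. For a
real submanifold all `J`-terms vanish, and the bound of (a) becomes that of (b).

The Gauss equation needs a calculus of vector fields along `f`. Near a point such a field is a
combination of restricted coordinate fields (`along_induction`), and this reduces the chain rule,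
the curvature identity and duality along `f` to the ambient statements and to the symmetry of second
derivatives. -/

noncomputable section

set_option linter.unusedSectionVars false

namespace QuaternionStatistical

/-! ### Vector fields along a map: differentiability and the derivative rules. -/

section Along

variable {F : Type*} [NormedAddCommGroup F] [NormedSpace ℝ F] [FiniteDimensional ℝ F]
  {N : Type*} [TopologicalSpace N] [ChartedSpace F N] [IsManifold 𝓘(ℝ, F) ∞ N]
  {E : Type*} [NormedAddCommGroup E] [NormedSpace ℝ E] [FiniteDimensional ℝ E]
  {M : Type*} [TopologicalSpace M] [ChartedSpace E M] [IsManifold 𝓘(ℝ, E) ∞ M]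

variable (F E) in
/-- Differentiability at `p` of a vector field along a map `f`. -/
def MDiffAlong (f : N → M) (V : Π q : N, TangentSpace 𝓘(ℝ, E) (f q)) (p : N) : Prop :=
  MDifferentiableAt 𝓘(ℝ, F) (𝓘(ℝ, E).prod 𝓘(ℝ, E))
    (fun q ↦ (⟨f q, V q⟩ : TotalSpace E (TangentSpace 𝓘(ℝ, E) : M → Type _))) p

variable {f : N → M} {V W : Π q : N, TangentSpace 𝓘(ℝ, E) (f q)} {p : N}
  (cov : CovariantDerivative 𝓘(ℝ, E) E (TangentSpace 𝓘(ℝ, E) : M → Type _))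

lemma MDiffAlong.base (hV : MDiffAlong F E f V p) : MDifferentiableAt 𝓘(ℝ, F) 𝓘(ℝ, E) f p :=
  ((mdifferentiableAt_totalSpace _ _).1 hV).1

lemma mdiffAlong_iff {x : M} (hx : f p ∈ (chartAt E x).source) :
    MDiffAlong F E f V p ↔ MDifferentiableAt 𝓘(ℝ, F) 𝓘(ℝ, E) f p ∧
      MDifferentiableAt 𝓘(ℝ, F) 𝓘(ℝ, E) (fun q ↦
        (trivializationAt E (TangentSpace 𝓘(ℝ, E) : M → Type _) x ⟨f q, V q⟩).2) p :=
  (trivializationAt E (TangentSpace 𝓘(ℝ, E) : M → Type _) x).mdifferentiableAt_totalSpace_iff _ _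
    (by simpa using hx)

lemma trivializationAt_snd_add {x y : M} (hy : y ∈ (chartAt E x).source)
    (v w : TangentSpace 𝓘(ℝ, E) y) :
    (trivializationAt E (TangentSpace 𝓘(ℝ, E) : M → Type _) x ⟨y, v + w⟩).2
      = (trivializationAt E (TangentSpace 𝓘(ℝ, E) : M → Type _) x ⟨y, v⟩).2
        + (trivializationAt E (TangentSpace 𝓘(ℝ, E) : M → Type _) x ⟨y, w⟩).2 :=
  ((trivializationAt E (TangentSpace 𝓘(ℝ, E) : M → Type _) x).linear ℝ (by simpa using hy)).map_add
    v w

lemma trivializationAt_snd_smul {x y : M} (hy : y ∈ (chartAt E x).source)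
    (c : ℝ) (v : TangentSpace 𝓘(ℝ, E) y) :
    (trivializationAt E (TangentSpace 𝓘(ℝ, E) : M → Type _) x ⟨y, c • v⟩).2
      = c • (trivializationAt E (TangentSpace 𝓘(ℝ, E) : M → Type _) x ⟨y, v⟩).2 :=
  ((trivializationAt E (TangentSpace 𝓘(ℝ, E) : M → Type _) x).linear ℝ (by simpa using hy)).map_smul
    c v

lemma eventually_mem_chartAt_source (hf : ContinuousAt f p) :
    ∀ᶠ q in 𝓝 p, f q ∈ (chartAt E (f p)).source :=
  hf.eventually ((chartAt E (f p)).open_source.mem_nhds (mem_chart_source E (f p)))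

lemma MDiffAlong.add (hV : MDiffAlong F E f V p) (hW : MDiffAlong F E f W p) :
    MDiffAlong F E f (fun q ↦ V q + W q) p := by
  have hx := mem_chart_source E (f p)
  have hV' := (mdiffAlong_iff hx).1 hV
  have hW' := (mdiffAlong_iff hx).1 hW
  refine (mdiffAlong_iff (V := fun q ↦ V q + W q) hx).2 ⟨hV.base, ?_⟩
  refine (hV'.2.add hW'.2).congr_of_eventuallyEq ?_
  filter_upwards [eventually_mem_chartAt_source (E := E) hV'.1.continuousAt] with q hq
  exact trivializationAt_snd_add hq _ _

lemma MDiffAlong.smul {a : N → ℝ} (ha : MDiffAt a p) (hV : MDiffAlong F E f V p) :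
    MDiffAlong F E f (fun q ↦ a q • V q) p := by
  have hx := mem_chart_source E (f p)
  have hV' := (mdiffAlong_iff hx).1 hV
  refine (mdiffAlong_iff (V := fun q ↦ a q • V q) hx).2 ⟨hV.base, ?_⟩
  refine (ha.smul hV'.2).congr_of_eventuallyEq ?_
  filter_upwards [eventually_mem_chartAt_source (E := E) hV'.1.continuousAt] with q hq
  exact trivializationAt_snd_smul hq _ _

lemma MDiffAlong.congr (hV : MDiffAlong F E f V p) (h : ∀ᶠ q in 𝓝 p, W q = V q) :
    MDiffAlong F E f W p :=
  MDifferentiableAt.congr_of_eventuallyEq hV (h.mono fun q hq ↦ by simp [hq])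

lemma MDiffAlong.comp {Z : Π x : M, TangentSpace 𝓘(ℝ, E) x} (hZ : MDiffAt (T% Z) (f p))
    (hf : MDifferentiableAt 𝓘(ℝ, F) 𝓘(ℝ, E) f p) : MDiffAlong F E f (fun q ↦ Z (f q)) p :=
  MDifferentiableAt.comp p hZ hf

lemma mvfderiv_congr {G : Type*} [NormedAddCommGroup G] [NormedSpace ℝ G] {h k : N → G}
    (hk : h =ᶠ[𝓝 p] k) : d% h p = d% k p := by
  ext u
  change mfderiv 𝓘(ℝ, F) 𝓘(ℝ, G) h p u = mfderiv 𝓘(ℝ, F) 𝓘(ℝ, G) k p u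
  rw [hk.mfderiv_eq]
  rfl

lemma symmL_trivializationAt_snd {x y : M} (hy : y ∈ (chartAt E x).source)
    (v : TangentSpace 𝓘(ℝ, E) y) :
    (trivializationAt E (TangentSpace 𝓘(ℝ, E) : M → Type _) x).symmL ℝ y
      (trivializationAt E (TangentSpace 𝓘(ℝ, E) : M → Type _) x ⟨y, v⟩).2 = v := by
  rw [Trivialization.symmL_apply _ (by simpa using hy)]
  exact Trivialization.symm_apply_apply_mk _ (by simpa using hy) v

lemma extend_eq_symmL {x y : M} (hy : y ∈ (chartAt E x).source) (v : TangentSpace 𝓘(ℝ, E) x) :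
    extend E v y = (trivializationAt E (TangentSpace 𝓘(ℝ, E) : M → Type _) x).symmL ℝ y
      (trivializationAt E (TangentSpace 𝓘(ℝ, E) : M → Type _) x ⟨x, v⟩).2 :=
  (Trivialization.symmL_apply _ (by simpa using hy) _).symm

/-- With the continuous linear map `symmL` in place of the bare inverse of the trivialization,
linearity becomes available to rewriting. -/
lemma derivAlong_eq (u : TangentSpace 𝓘(ℝ, F) p) :
    derivAlong cov f V p u = (trivializationAt E (TangentSpace 𝓘(ℝ, E) : M → Type _) (f p)).symmL ℝ
        (f p) (d% (fun q ↦ (trivializationAt E (TangentSpace 𝓘(ℝ, E) : M → Type _) (f p)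
          ⟨f q, V q⟩).2) p u)
      + cov (extend E (V p)) (f p) (mfderiv 𝓘(ℝ, F) 𝓘(ℝ, E) f p u) := by
  rw [Trivialization.symmL_apply _ (FiberBundle.mem_baseSet_trivializationAt' _)]
  rfl

lemma derivAlong_congr (h : ∀ᶠ q in 𝓝 p, W q = V q) (u : TangentSpace 𝓘(ℝ, F) p) :
    derivAlong cov f W p u = derivAlong cov f V p u := by
  rw [derivAlong_eq, derivAlong_eq, h.self_of_nhds, mvfderiv_congr (k := fun q ↦
    (trivializationAt E (TangentSpace 𝓘(ℝ, E) : M → Type _) (f p) ⟨f q, V q⟩).2)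
    (h.mono fun q hq ↦ by simp [hq])]

/-- Trivializations are fibrewise linear over the chart domain; a local statement is enough because
covariant derivatives depend on germs only. -/
lemma eventually_extend_add {x : M} (v w : TangentSpace 𝓘(ℝ, E) x) :
    ∀ᶠ y in 𝓝 x, extend E (v + w) y = (extend E v + extend E w : Π _ : M, _) y := by
  filter_upwards [(chartAt E x).open_source.mem_nhds (mem_chart_source E x)] with y hy
  simp only [extend_eq_symmL hy, Pi.add_apply, trivializationAt_snd_add (mem_chart_source E x),
    map_add]

lemma eventually_extend_smul {x : M} (c : ℝ) (v : TangentSpace 𝓘(ℝ, E) x) :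
    ∀ᶠ y in 𝓝 x, extend E (c • v) y = (c • extend E v : Π _ : M, _) y := by
  filter_upwards [(chartAt E x).open_source.mem_nhds (mem_chart_source E x)] with y hy
  simp only [extend_eq_symmL hy, Pi.smul_apply, trivializationAt_snd_smul (mem_chart_source E x),
    map_smul]

lemma mdiffAt_extend {x : M} (v : TangentSpace 𝓘(ℝ, E) x) :
    MDiffAt (T% (extend E v : Π y : M, TangentSpace 𝓘(ℝ, E) y)) x :=
  mdifferentiableAt_extend ..

lemma cov_congr {X Y : Π y : M, TangentSpace 𝓘(ℝ, E) y} {x : M} (hX : MDiffAt (T% X) x)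
    (h : ∀ᶠ y in 𝓝 x, Y y = X y) : cov Y x = cov X x :=
  cov.isCovariantDerivativeOnUniv.congr_of_eventuallyEq
    (hX.congr_of_eventuallyEq (h.mono fun y hy ↦ by simp [hy])) hX Filter.univ_mem h

lemma cov_extend_add {x : M} (v w : TangentSpace 𝓘(ℝ, E) x) :
    cov (extend E (v + w)) x = cov (extend E v) x + cov (extend E w) x := by
  rw [← cov.isCovariantDerivativeOnUniv.add (mdiffAt_extend v) (mdiffAt_extend w)]
  exact cov_congr cov (mdifferentiableAt_add_section (mdiffAt_extend v) (mdiffAt_extend w))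
    (eventually_extend_add v w)

lemma cov_extend_smul {x : M} (c : ℝ) (v : TangentSpace 𝓘(ℝ, E) x) :
    cov (extend E (c • v)) x = c • cov (extend E v) x := by
  rw [← cov.isCovariantDerivativeOnUniv.smul_const c (mdiffAt_extend v)]
  exact cov_congr cov (MDifferentiableAt.smul_const_section (mdiffAt_extend v))
    (eventually_extend_smul c v)

lemma derivAlong_add (hV : MDiffAlong F E f V p) (hW : MDiffAlong F E f W p)
    (u : TangentSpace 𝓘(ℝ, F) p) :
    derivAlong cov f (fun q ↦ V q + W q) p u
      = derivAlong cov f V p u + derivAlong cov f W p u := by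
  have hx := mem_chart_source E (f p)
  have hV' := ((mdiffAlong_iff hx).1 hV).2
  have hW' := ((mdiffAlong_iff hx).1 hW).2
  simp only [derivAlong_eq]
  rw [cov_extend_add, mvfderiv_congr (k := fun q ↦
      (trivializationAt E (TangentSpace 𝓘(ℝ, E) : M → Type _) (f p) ⟨f q, V q⟩).2 +
      (trivializationAt E (TangentSpace 𝓘(ℝ, E) : M → Type _) (f p) ⟨f q, W q⟩).2)
      ((eventually_mem_chartAt_source hV.base.continuousAt).mono
        fun q hq ↦ trivializationAt_snd_add hq _ _),
    mvfderiv_fun_add hV' hW']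
  simp only [add_apply, map_add]
  abel

/-- The derivative of the components obeys the product rule, while the connection term depends on `V
p` alone and linearly. -/
lemma derivAlong_smul {a : N → ℝ} (ha : MDiffAt a p) (hV : MDiffAlong F E f V p)
    (u : TangentSpace 𝓘(ℝ, F) p) :
    derivAlong cov f (fun q ↦ a q • V q) p u
      = d% a p u • V p + a p • derivAlong cov f V p u := by
  have hx := mem_chart_source E (f p)
  have hV' := ((mdiffAlong_iff hx).1 hV).2
  simp only [derivAlong_eq]
  rw [cov_extend_smul, mvfderiv_congr (k := fun q ↦
      a q • (trivializationAt E (TangentSpace 𝓘(ℝ, E) : M → Type _) (f p) ⟨f q, V q⟩).2)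
      ((eventually_mem_chartAt_source hV.base.continuousAt).mono
        fun q hq ↦ trivializationAt_snd_smul hq _ _),
    mvfderiv_fun_smul ha hV']
  simp only [add_apply, map_add, smul_apply, map_smul, ContinuousLinearMap.smulRight_apply,
    symmL_trivializationAt_snd hx]
  module

end Along

/-! ### Reduction to coordinate fields, and the chain rule. -/

section Along

variable {F : Type*} [NormedAddCommGroup F] [NormedSpace ℝ F] [FiniteDimensional ℝ F]
  {N : Type*} [TopologicalSpace N] [ChartedSpace F N] [IsManifold 𝓘(ℝ, F) ∞ N]
  {E : Type*} [NormedAddCommGroup E] [NormedSpace ℝ E] [FiniteDimensional ℝ E]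
  {M : Type*} [TopologicalSpace M] [ChartedSpace E M] [IsManifold 𝓘(ℝ, E) ∞ M]
variable {f : N → M} {V W : Π q : N, TangentSpace 𝓘(ℝ, E) (f q)} {p : N}
  (cov : CovariantDerivative 𝓘(ℝ, E) E (TangentSpace 𝓘(ℝ, E) : M → Type _))

/-- The components, in the chart at `x`, of a tangent vector. -/
def chartCoeff (x : M) (k : Fin (Module.finrank ℝ E)) (y : M) (v : TangentSpace 𝓘(ℝ, E) y) : ℝ :=
  (Module.finBasis ℝ E).coord k
    (trivializationAt E (TangentSpace 𝓘(ℝ, E) : M → Type _) x ⟨y, v⟩).2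

/-- The value at `x` of the coordinate fields of the chart at `x`. -/
def chartVec (x : M) (k : Fin (Module.finrank ℝ E)) : TangentSpace 𝓘(ℝ, E) x :=
  (trivializationAt E (TangentSpace 𝓘(ℝ, E) : M → Type _) x).symmL ℝ x (Module.finBasis ℝ E k)

lemma trivializationAt_symmL_snd {x y : M} (hy : y ∈ (chartAt E x).source) (v : E) :
    (trivializationAt E (TangentSpace 𝓘(ℝ, E) : M → Type _) x ⟨y,
      (trivializationAt E (TangentSpace 𝓘(ℝ, E) : M → Type _) x).symmL ℝ y v⟩).2 = v := by
  rw [Trivialization.symmL_apply _ (by simpa using hy),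
    Trivialization.apply_mk_symm _ (by simpa using hy)]

lemma eq_sum_chartCoeff {x y : M} (hy : y ∈ (chartAt E x).source) (v : TangentSpace 𝓘(ℝ, E) y) :
    v = ∑ k, chartCoeff x k y v • extend E (chartVec x k) y := by
  conv_lhs => rw [← symmL_trivializationAt_snd hy v, ← (Module.finBasis ℝ E).sum_repr
    (trivializationAt E (TangentSpace 𝓘(ℝ, E) : M → Type _) x ⟨y, v⟩).2, map_sum]
  refine Finset.sum_congr rfl fun k _ ↦ ?_
  rw [map_smul, extend_eq_symmL hy, chartVec, trivializationAt_symmL_snd (mem_chart_source E x)]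
  rfl

/-- To prove a statement about a vector field along a map near a point, it suffices to prove it
for restrictions of coordinate fields and to check that it is stable under linear combinations
whose coefficients are as regular as the components of the field. -/
theorem along_induction {C : (N → ℝ) → Prop}
    {P : (Π q : N, TangentSpace 𝓘(ℝ, E) (f q)) → Prop}
    (congr : ∀ V W, (∀ᶠ q in 𝓝 p, W q = V q) → P V → P W)
    (zero : P fun _ ↦ 0)
    (add : ∀ V W, P V → P W → P fun q ↦ V q + W q)
    (smul : ∀ a V, C a → P V → P fun q ↦ a q • V q)
    (ext : ∀ v : TangentSpace 𝓘(ℝ, E) (f p), P fun q ↦ extend E v (f q))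
    (hf : ContinuousAt f p) (hV : ∀ k, C fun q ↦ chartCoeff (f p) k (f q) (V q)) : P V := by
  have key : ∀ s : Finset (Fin (Module.finrank ℝ E)), P fun q ↦
      ∑ k ∈ s, chartCoeff (f p) k (f q) (V q) • extend E (chartVec (f p) k) (f q) := by
    intro s
    induction s using Finset.induction_on with
    | empty => simpa using zero
    | insert k s hk ih =>
      simp only [Finset.sum_insert hk]
      exact add _ _ (smul _ _ (hV k) (ext _)) ih
  refine congr _ _ ?_ (key Finset.univ)
  filter_upwards [eventually_mem_chartAt_source (E := E) hf] with q hq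
  exact eq_sum_chartCoeff hq _

lemma MDiffAlong.chartCoeff (hV : MDiffAlong F E f V p) (k : Fin (Module.finrank ℝ E)) :
    MDiffAt (fun q ↦ chartCoeff (f p) k (f q) (V q)) p := by
  have h := ((mdiffAlong_iff (mem_chart_source E (f p))).1 hV).2
  have h2 : DifferentiableAt ℝ ((Module.finBasis ℝ E).coord k).toContinuousLinearMap
    (trivializationAt E (TangentSpace 𝓘(ℝ, E) : M → Type _) (f p) ⟨f p, V p⟩).2 :=
    ContinuousLinearMap.differentiableAt _
  exact h2.mdifferentiableAt.comp p h

lemma MDiffAlong.zero (hf : MDifferentiableAt 𝓘(ℝ, F) 𝓘(ℝ, E) f p) :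
    MDiffAlong F E f (fun _ ↦ 0) p :=
  MDiffAlong.comp (Z := fun _ ↦ 0) (mdifferentiableAt_zeroSection ..) hf

lemma MDiffAlong.extend_comp (hf : MDifferentiableAt 𝓘(ℝ, F) 𝓘(ℝ, E) f p)
    (v : TangentSpace 𝓘(ℝ, E) (f p)) : MDiffAlong F E f (fun q ↦ extend E v (f q)) p :=
  .comp (mdiffAt_extend v) hf

lemma derivAlong_zero (hf : MDifferentiableAt 𝓘(ℝ, F) 𝓘(ℝ, E) f p) (u : TangentSpace 𝓘(ℝ, F) p) :
    derivAlong cov f (fun _ ↦ 0) p u = 0 := by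
  have := derivAlong_add cov (MDiffAlong.zero hf) (MDiffAlong.zero hf) u
  simpa using this

lemma derivAlong_extend (hf : ContinuousAt f p) (v : TangentSpace 𝓘(ℝ, E) (f p))
    (u : TangentSpace 𝓘(ℝ, F) p) : derivAlong cov f (fun q ↦ extend E v (f q)) p u
      = cov (extend E v) (f p) (mfderiv 𝓘(ℝ, F) 𝓘(ℝ, E) f p u) := by
  rw [derivAlong_eq, extend_apply_self, mvfderiv_congr (k := fun q ↦
    (trivializationAt E (TangentSpace 𝓘(ℝ, E) : M → Type _) (f p) ⟨f p, v⟩).2), mvfderiv_const]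
  · simp
  · filter_upwards [eventually_mem_chartAt_source (E := E) hf] with q hq
    rw [extend_eq_symmL hq, trivializationAt_symmL_snd hq]

/-- The chain rule for the derivative along a map of the restriction of a vector field. -/
theorem derivAlong_comp {Z : Π x : M, TangentSpace 𝓘(ℝ, E) x} (hZ : MDiffAt (T% Z) (f p))
    (hf : MDifferentiableAt 𝓘(ℝ, F) 𝓘(ℝ, E) f p) (u : TangentSpace 𝓘(ℝ, F) p) :
    derivAlong cov f (fun q ↦ Z (f q)) p u
      = cov Z (f p) (mfderiv 𝓘(ℝ, F) 𝓘(ℝ, E) f p u) := by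
  -- The field `Z` is decomposed on `M` itself, as a field along the identity. Differentiability is
  -- part of the predicate because both Leibniz rules require it.
  refine (along_induction (N := M) (f := id) (p := f p) (C := fun a ↦ MDiffAt a (f p))
    (P := fun Z : Π y : M, TangentSpace 𝓘(ℝ, E) y ↦ MDiffAt (T% Z) (f p) ∧
      derivAlong cov f (fun q ↦ Z (f q)) p u = cov Z (f p) (mfderiv 𝓘(ℝ, F) 𝓘(ℝ, E) f p u))
    ?_ ?_ ?_ ?_ ?_ continuousAt_id ?_).2
  · rintro V W h ⟨h1, h2⟩
    refine ⟨h1.congr_of_eventuallyEq (h.mono fun y hy ↦ by simp [hy]), ?_⟩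
    rw [derivAlong_congr (f := f) (V := fun q ↦ V (f q)) (W := fun q ↦ W (f q)) cov
      (hf.continuousAt.eventually h), h2, cov_congr cov h1 h]
  · refine ⟨mdifferentiableAt_zeroSection .., ?_⟩
    rw [derivAlong_zero cov hf]
    change _ = cov 0 _ _
    simp
  · rintro V W ⟨h1, h2⟩ ⟨h3, h4⟩
    refine ⟨mdifferentiableAt_add_section h1 h3, ?_⟩
    rw [derivAlong_add cov (.comp h1 hf) (.comp h3 hf), h2, h4, ← add_apply,
      ← cov.isCovariantDerivativeOnUniv.add h1 h3]
    rfl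
  · rintro a V ha ⟨h1, h2⟩
    refine ⟨ha.smul_section h1, ?_⟩
    rw [derivAlong_smul cov (a := fun q ↦ a (f q)) (ha.comp p hf) (.comp h1 hf), h2]
    have h3 := cov.isCovariantDerivativeOnUniv.leibniz h1 ha
    have h4 : d% (fun q ↦ a (f q)) p = (d% a (f p)).comp (mfderiv 𝓘(ℝ, F) 𝓘(ℝ, E) f p) :=
      mfderiv_comp p ha hf
    change _ = cov (a • V) (f p) _
    rw [h3, h4]
    simp [add_comm]
  · intro v
    exact ⟨mdiffAt_extend v, derivAlong_extend cov hf.continuousAt v u⟩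
  · intro k
    exact MDiffAlong.chartCoeff (N := M) (f := id) hZ k

end Along

/-! ### Coordinate fields commute. -/

section SecondDerivatives

variable {F : Type*} [NormedAddCommGroup F] [NormedSpace ℝ F] [FiniteDimensional ℝ F]
  {N : Type*} [TopologicalSpace N] [ChartedSpace F N] [IsManifold 𝓘(ℝ, F) ∞ N]
  {G : Type*} [NormedAddCommGroup G] [NormedSpace ℝ G] {p : N}

lemma extend_eq_mfderivWithin {q : N} (hq : q ∈ (chartAt F p).source)
    (v : TangentSpace 𝓘(ℝ, F) p) :
    extend F v q = mfderiv 𝓘(ℝ, F) 𝓘(ℝ, F) (extChartAt 𝓘(ℝ, F) p).symm (extChartAt 𝓘(ℝ, F) p q)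
      (trivializationAt F (TangentSpace 𝓘(ℝ, F) : N → Type _) p ⟨p, v⟩).2 := by
  rw [extend_eq_symmL hq, TangentBundle.symmL_trivializationAt hq, modelWithCornersSelf_coe,
    Set.range_id, mfderivWithin_univ]
  rfl

/-- A coordinate field is the push-forward of a constant field under the inverse chart, so this is a
directional derivative in a fixed direction of the vector space `F`. -/
lemma mfderiv_extend {h : N → G} {q : N} (hq : q ∈ (chartAt F p).source) (hh : MDiffAt h q)
    (v : TangentSpace 𝓘(ℝ, F) p) :
    d% h q (extend F v q) = fderiv ℝ (h ∘ (extChartAt 𝓘(ℝ, F) p).symm) (extChartAt 𝓘(ℝ, F) p q)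
      (trivializationAt F (TangentSpace 𝓘(ℝ, F) : N → Type _) p ⟨p, v⟩).2 := by
  rw [extend_eq_mfderivWithin hq]
  have hφ : MDifferentiableAt 𝓘(ℝ, F) 𝓘(ℝ, F) (extChartAt 𝓘(ℝ, F) p).symm
      (extChartAt 𝓘(ℝ, F) p q) := by
    have := mdifferentiableWithinAt_extChartAt_symm (I := 𝓘(ℝ, F))
      ((extChartAt 𝓘(ℝ, F) p).map_source (by rwa [extChartAt_source]))
    rwa [modelWithCornersSelf_coe, Set.range_id, mdifferentiableWithinAt_univ] at this
  have hq' : (extChartAt 𝓘(ℝ, F) p).symm (extChartAt 𝓘(ℝ, F) p q) = q :=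
    (extChartAt 𝓘(ℝ, F) p).left_inv (by rwa [extChartAt_source])
  have := mfderiv_comp_of_eq hh hφ hq'
  -- The points `q` and `φ⁻¹(φ q)` agree only propositionally; reading the derivatives as maps `F
  -- →L[ℝ] G` avoids a transport between tangent spaces.
  have hcongr : ∀ q' w, q' = q → (mfderiv 𝓘(ℝ, F) 𝓘(ℝ, G) h q : F →L[ℝ] G) w
      = (mfderiv 𝓘(ℝ, F) 𝓘(ℝ, G) h q' : F →L[ℝ] G) w := by
    rintro q' w rfl
    rfl
  rw [← mfderiv_eq_fderiv, this]
  exact hcongr _ _ hq'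

lemma contDiffAt_comp_extChartAt_symm {n : ℕ∞} {h : N → G}
    (hh : ContMDiffAt 𝓘(ℝ, F) 𝓘(ℝ, G) n h p) :
    ContDiffAt ℝ n (h ∘ (extChartAt 𝓘(ℝ, F) p).symm) (extChartAt 𝓘(ℝ, F) p p) := by
  have := ((contMDiffAt_iff_target).1 hh).2
  have := (contMDiffAt_iff.1 hh).2
  rw [modelWithCornersSelf_coe, Set.range_id, contDiffWithinAt_univ] at this
  exact this

lemma eventually_mvfderiv_extend {h : N → G} (hh : ContMDiffAt 𝓘(ℝ, F) 𝓘(ℝ, G) 1 h p)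
    (v : TangentSpace 𝓘(ℝ, F) p) :
    (fun q ↦ d% h q (extend F v q)) =ᶠ[𝓝 p]
      (fun y ↦ fderiv ℝ (h ∘ (extChartAt 𝓘(ℝ, F) p).symm) y
        (trivializationAt F (TangentSpace 𝓘(ℝ, F) : N → Type _) p ⟨p, v⟩).2) ∘
          extChartAt 𝓘(ℝ, F) p := by
  filter_upwards [(contMDiffAt_iff_contMDiffAt_nhds (by simp)).1 hh,
    (chartAt F p).open_source.mem_nhds (mem_chart_source F p)] with q hq hq'
  exact mfderiv_extend hq' (hq.mdifferentiableAt (by simp)) v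

lemma contMDiffAt_mvfderiv_extend {n : ℕ∞} {h : N → G}
    (hh : ContMDiffAt 𝓘(ℝ, F) 𝓘(ℝ, G) (n + 1) h p) (v : TangentSpace 𝓘(ℝ, F) p) :
    ContMDiffAt 𝓘(ℝ, F) 𝓘(ℝ, G) n (fun q ↦ d% h q (extend F v q)) p := by
  refine ContMDiffAt.congr_of_eventuallyEq ?_ (eventually_mvfderiv_extend (hh.of_le (by simp)) v)
  have h1 : ContDiffAt ℝ (n + 1) (h ∘ (extChartAt 𝓘(ℝ, F) p).symm) (extChartAt 𝓘(ℝ, F) p p) := 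
    contDiffAt_comp_extChartAt_symm (n := n + 1) hh
  have h2 := (h1.fderiv_right (m := n) le_rfl).clm_apply (contDiffAt_const
    (c := (trivializationAt F (TangentSpace 𝓘(ℝ, F) : N → Type _) p ⟨p, v⟩).2))
  exact h2.contMDiffAt.comp p contMDiffAt_extChartAt

/-- Second derivatives in the directions of two coordinate fields commute. -/
theorem mvfderiv_extend_comm {h : N → G} (hh : ContMDiffAt 𝓘(ℝ, F) 𝓘(ℝ, G) 2 h p)
    (u v : TangentSpace 𝓘(ℝ, F) p) :
    d% (fun q ↦ d% h q (extend F v q)) p u = d% (fun q ↦ d% h q (extend F u q)) p v := by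
  have h1 := contDiffAt_comp_extChartAt_symm (n := 2) hh
  have h2 : ∀ u v : TangentSpace 𝓘(ℝ, F) p, d% (fun q ↦ d% h q (extend F v q)) p u =
      fderiv ℝ (fderiv ℝ (h ∘ (extChartAt 𝓘(ℝ, F) p).symm)) (extChartAt 𝓘(ℝ, F) p p)
        (trivializationAt F (TangentSpace 𝓘(ℝ, F) : N → Type _) p ⟨p, u⟩).2
        (trivializationAt F (TangentSpace 𝓘(ℝ, F) : N → Type _) p ⟨p, v⟩).2 := by
    intro u v
    have h3 : MDiffAt (fun q ↦ d% h q (extend F v q)) p :=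
      (contMDiffAt_mvfderiv_extend (n := 1) hh v).mdifferentiableAt (by simp)
    have h4 := mfderiv_extend (mem_chart_source F p) h3 u
    rw [extend_apply_self] at h4
    rw [h4]
    have h5 : (fun q ↦ d% h q (extend F v q)) ∘ (extChartAt 𝓘(ℝ, F) p).symm =ᶠ[𝓝
        (extChartAt 𝓘(ℝ, F) p p)] fun y ↦ fderiv ℝ (h ∘ (extChartAt 𝓘(ℝ, F) p).symm) y
        (trivializationAt F (TangentSpace 𝓘(ℝ, F) : N → Type _) p ⟨p, v⟩).2 := by
      have h6 := continuousAt_extChartAt_symm (I := 𝓘(ℝ, F)) p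
      rw [ContinuousAt, extChartAt_to_inv] at h6
      filter_upwards [h6.eventually (eventually_mvfderiv_extend (hh.of_le (by simp)) v),
        extChartAt_target_mem_nhds (I := 𝓘(ℝ, F)) p] with y hy hy'
      rw [Function.comp_apply, hy, Function.comp_apply, (extChartAt 𝓘(ℝ, F) p).right_inv hy']
    -- The direction is constant, so only the second-derivative term of the product rule survives.
    rw [h5.fderiv_eq, fderiv_clm_apply ((h1.fderiv_right (m := 1) le_rfl).differentiableAt
      (by simp)) (by fun_prop)]
    simp
  rw [h2, h2]
  exact (h1.isSymmSndFDerivAt (by simp)).eq _ _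

lemma lieBracketWithin_eq_zero_of_eventually_const {A B : F → F} {x a b : F}
    (hA : A =ᶠ[𝓝 x] fun _ ↦ a) (hB : B =ᶠ[𝓝 x] fun _ ↦ b) :
    lieBracketWithin ℝ A B Set.univ x = 0 := by
  simp [lieBracketWithin, hA.fderiv_eq, hB.fderiv_eq]

/-- Pulled back to the chart, both fields are constant near the point. -/
lemma mlieBracket_extend (u v : TangentSpace 𝓘(ℝ, F) p) :
    mlieBracket 𝓘(ℝ, F) (extend F u) (extend F v) p = 0 := by
  have key : ∀ w : TangentSpace 𝓘(ℝ, F) p, ∀ᶠ y in 𝓝 (extChartAt 𝓘(ℝ, F) p p),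
      mpullbackWithin 𝓘(ℝ, F) 𝓘(ℝ, F) (extChartAt 𝓘(ℝ, F) p).symm (extend F w) Set.univ y
        = (trivializationAt F (TangentSpace 𝓘(ℝ, F) : N → Type _) p ⟨p, w⟩).2 := by
    intro w
    filter_upwards [extChartAt_target_mem_nhds (I := 𝓘(ℝ, F)) p] with y hy
    have h1 := (extChartAt 𝓘(ℝ, F) p).map_target hy
    rw [extChartAt_source] at h1
    have h2 := isInvertible_mfderivWithin_extChartAt_symm (I := 𝓘(ℝ, F)) hy
    rw [modelWithCornersSelf_coe, Set.range_id, mfderivWithin_univ] at h2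
    rw [mpullbackWithin_apply, mfderivWithin_univ, extend_eq_mfderivWithin h1,
      (extChartAt 𝓘(ℝ, F) p).right_inv hy]
    exact h2.inverse_apply_eq.2 rfl
  rw [← mlieBracketWithin_univ, mlieBracketWithin_apply, modelWithCornersSelf_coe, Set.range_id,
    Set.preimage_univ, Set.univ_inter]
  exact (congrArg _ (lieBracketWithin_eq_zero_of_eventually_const (key u) (key v))).trans
    (map_zero _)

end SecondDerivatives

/-! ### The differential of a map, and symmetry of the second fundamental form. -/

section Along

variable {F : Type*} [NormedAddCommGroup F] [NormedSpace ℝ F] [FiniteDimensional ℝ F]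
  {N : Type*} [TopologicalSpace N] [ChartedSpace F N] [IsManifold 𝓘(ℝ, F) ∞ N]
  {E : Type*} [NormedAddCommGroup E] [NormedSpace ℝ E] [FiniteDimensional ℝ E]
  {M : Type*} [TopologicalSpace M] [ChartedSpace E M] [IsManifold 𝓘(ℝ, E) ∞ M]
variable {f : N → M} {p : N}
  (cov : CovariantDerivative 𝓘(ℝ, E) E (TangentSpace 𝓘(ℝ, E) : M → Type _))

/-- This identifies derivatives of the components of `df` with second derivatives of the
vector-valued function `φ ∘ f`, which commute. -/
lemma trivializationAt_mfderiv_snd {x : M} {q : N} (hq : f q ∈ (chartAt E x).source)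
    (hf : MDifferentiableAt 𝓘(ℝ, F) 𝓘(ℝ, E) f q) (w : TangentSpace 𝓘(ℝ, F) q) :
    (trivializationAt E (TangentSpace 𝓘(ℝ, E) : M → Type _) x
      ⟨f q, mfderiv 𝓘(ℝ, F) 𝓘(ℝ, E) f q w⟩).2 = d% (extChartAt 𝓘(ℝ, E) x ∘ f) q w := by
  have h1 := mfderiv_comp q (mdifferentiableAt_extChartAt (I := 𝓘(ℝ, E)) hq) hf
  have h2 := TangentBundle.continuousLinearMapAt_trivializationAt (I := 𝓘(ℝ, E)) hq
  have h4 : (trivializationAt E (TangentSpace 𝓘(ℝ, E) : M → Type _) x).continuousLinearMapAt ℝ (f q)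
      (mfderiv 𝓘(ℝ, F) 𝓘(ℝ, E) f q w) = (trivializationAt E (TangentSpace 𝓘(ℝ, E) : M → Type _) x
      ⟨f q, mfderiv 𝓘(ℝ, F) 𝓘(ℝ, E) f q w⟩).2 := by
    rw [Trivialization.continuousLinearMapAt_apply, Trivialization.linearMapAt_apply,
      if_pos (by simpa using hq)]
  rw [h2] at h4
  rw [← h4]
  change _ = mfderiv 𝓘(ℝ, F) 𝓘(ℝ, E) (extChartAt 𝓘(ℝ, E) x ∘ f) q w
  rw [h1]
  rfl

lemma contMDiffAt_extChartAt_comp (hf : ContMDiff 𝓘(ℝ, F) 𝓘(ℝ, E) ∞ f) :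
    ContMDiffAt 𝓘(ℝ, F) 𝓘(ℝ, E) ∞ (extChartAt 𝓘(ℝ, E) (f p) ∘ f) p :=
  contMDiffAt_extChartAt.comp p hf.contMDiffAt

lemma eventually_trivializationAt_mfderiv_extend (hf : ContMDiff 𝓘(ℝ, F) 𝓘(ℝ, E) ∞ f)
    (v : TangentSpace 𝓘(ℝ, F) p) :
    (fun q ↦ (trivializationAt E (TangentSpace 𝓘(ℝ, E) : M → Type _) (f p)
      ⟨f q, mfderiv 𝓘(ℝ, F) 𝓘(ℝ, E) f q (extend F v q)⟩).2) =ᶠ[𝓝 p]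
      fun q ↦ d% (extChartAt 𝓘(ℝ, E) (f p) ∘ f) q (extend F v q) := by
  filter_upwards [eventually_mem_chartAt_source (E := E) hf.continuous.continuousAt] with q hq
  exact trivializationAt_mfderiv_snd hq (hf.mdifferentiable (by simp) q) _

lemma contMDiffAt_trivializationAt_mfderiv_extend (hf : ContMDiff 𝓘(ℝ, F) 𝓘(ℝ, E) ∞ f)
    (v : TangentSpace 𝓘(ℝ, F) p) :
    ContMDiffAt 𝓘(ℝ, F) 𝓘(ℝ, E) ∞ (fun q ↦ (trivializationAt E
      (TangentSpace 𝓘(ℝ, E) : M → Type _) (f p)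
      ⟨f q, mfderiv 𝓘(ℝ, F) 𝓘(ℝ, E) f q (extend F v q)⟩).2) p :=
  (contMDiffAt_mvfderiv_extend (n := ⊤) (contMDiffAt_extChartAt_comp hf) v).congr_of_eventuallyEq
    (eventually_trivializationAt_mfderiv_extend hf v)

lemma contMDiffAt_chartCoeff_mfderiv_extend (hf : ContMDiff 𝓘(ℝ, F) 𝓘(ℝ, E) ∞ f)
    (v : TangentSpace 𝓘(ℝ, F) p) (k : Fin (Module.finrank ℝ E)) :
    ContMDiffAt 𝓘(ℝ, F) 𝓘(ℝ, ℝ) ∞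
      (fun q ↦ chartCoeff (f p) k (f q) (mfderiv 𝓘(ℝ, F) 𝓘(ℝ, E) f q (extend F v q))) p := by
  have h2 : ContDiff ℝ ∞ ((Module.finBasis ℝ E).coord k).toContinuousLinearMap :=
    ContinuousLinearMap.contDiff _
  exact h2.contMDiff.contMDiffAt.comp p (contMDiffAt_trivializationAt_mfderiv_extend hf v)

lemma mvfderiv_trivializationAt_mfderiv_extend_comm (hf : ContMDiff 𝓘(ℝ, F) 𝓘(ℝ, E) ∞ f)
    (u v : TangentSpace 𝓘(ℝ, F) p) :
    d% (fun q ↦ (trivializationAt E (TangentSpace 𝓘(ℝ, E) : M → Type _) (f p)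
        ⟨f q, mfderiv 𝓘(ℝ, F) 𝓘(ℝ, E) f q (extend F v q)⟩).2) p u
      = d% (fun q ↦ (trivializationAt E (TangentSpace 𝓘(ℝ, E) : M → Type _) (f p)
        ⟨f q, mfderiv 𝓘(ℝ, F) 𝓘(ℝ, E) f q (extend F u q)⟩).2) p v := by
  rw [mvfderiv_congr (eventually_trivializationAt_mfderiv_extend hf v),
    mvfderiv_congr (eventually_trivializationAt_mfderiv_extend hf u)]
  exact mvfderiv_extend_comm ((contMDiffAt_extChartAt_comp hf).of_le
    (WithTop.coe_le_coe.2 (le_top (a := (2 : ℕ∞))))) u v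

/-- In the curvature identity along `f`, this removes the terms with second derivatives of `f`. -/
lemma mvfderiv_chartCoeff_mfderiv_extend_comm (hf : ContMDiff 𝓘(ℝ, F) 𝓘(ℝ, E) ∞ f)
    (u v : TangentSpace 𝓘(ℝ, F) p) (k : Fin (Module.finrank ℝ E)) :
    d% (fun q ↦ chartCoeff (f p) k (f q) (mfderiv 𝓘(ℝ, F) 𝓘(ℝ, E) f q (extend F v q))) p u
      = d% (fun q ↦ chartCoeff (f p) k (f q)
          (mfderiv 𝓘(ℝ, F) 𝓘(ℝ, E) f q (extend F u q))) p v := by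
  have key : ∀ u v : TangentSpace 𝓘(ℝ, F) p,
      d% (fun q ↦ chartCoeff (f p) k (f q) (mfderiv 𝓘(ℝ, F) 𝓘(ℝ, E) f q (extend F v q))) p u
      = ((Module.finBasis ℝ E).coord k).toContinuousLinearMap
        (d% (fun q ↦ (trivializationAt E (TangentSpace 𝓘(ℝ, E) : M → Type _) (f p)
        ⟨f q, mfderiv 𝓘(ℝ, F) 𝓘(ℝ, E) f q (extend F v q)⟩).2) p u) := by
    intro u v
    have h := (contMDiffAt_trivializationAt_mfderiv_extend hf v).mdifferentiableAt (by simp)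
    have h2 := (((Module.finBasis ℝ E).coord k).toContinuousLinearMap.differentiableAt
      (x := (trivializationAt E (TangentSpace 𝓘(ℝ, E) : M → Type _) (f p)
        ⟨f p, mfderiv 𝓘(ℝ, F) 𝓘(ℝ, E) f p (extend F v p)⟩).2)).mdifferentiableAt
    have h3 := mfderiv_comp p h2 h
    rw [mfderiv_eq_fderiv, ContinuousLinearMap.fderiv] at h3
    exact congrArg (fun L : F →L[ℝ] ℝ ↦ L u) h3
  rw [key, key, mvfderiv_trivializationAt_mfderiv_extend_comm hf]

lemma mdiffAlong_mfderiv_extend (hf : ContMDiff 𝓘(ℝ, F) 𝓘(ℝ, E) ∞ f)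
    (v : TangentSpace 𝓘(ℝ, F) p) :
    MDiffAlong F E f (fun q ↦ mfderiv 𝓘(ℝ, F) 𝓘(ℝ, E) f q (extend F v q)) p :=
  (mdiffAlong_iff (mem_chart_source E (f p))).2 ⟨hf.mdifferentiable (by simp) p,
    (contMDiffAt_trivializationAt_mfderiv_extend hf v).mdifferentiableAt (by simp)⟩

-- The bracket in the torsion vanishes on coordinate fields.
variable {cov} in
lemma cov_extend_comm (hcov : cov.torsion = 0) {x : M} (u v : TangentSpace 𝓘(ℝ, E) x) :
    cov (extend E v) x u = cov (extend E u) x v := by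
  have := cov.torsion_eq_zero_iff.1 hcov (mdiffAt_extend u) (mdiffAt_extend v)
  rw [mlieBracket_extend, sub_eq_zero] at this
  simpa using this

variable {cov} in
/-- The second fundamental form before projection is symmetric. -/
lemma ambientDeriv_extend_comm (hcov : cov.torsion = 0) (hf : ContMDiff 𝓘(ℝ, F) 𝓘(ℝ, E) ∞ f)
    (u v : TangentSpace 𝓘(ℝ, F) p) :
    ambientDeriv cov f (extend F v) p u = ambientDeriv cov f (extend F u) p v := by
  rw [ambientDeriv, ambientDeriv, derivAlong_eq, derivAlong_eq,
    mvfderiv_trivializationAt_mfderiv_extend_comm hf]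
  simp only [extend_apply_self]
  rw [cov_extend_comm hcov]

lemma secondFundamentalForm_comm
    {covN : CovariantDerivative 𝓘(ℝ, F) F (TangentSpace 𝓘(ℝ, F) : N → Type _)}
    {covM : CovariantDerivative 𝓘(ℝ, E) E (TangentSpace 𝓘(ℝ, E) : M → Type _)}
    (hN : covN.torsion = 0) (hM : covM.torsion = 0) (hf : ContMDiff 𝓘(ℝ, F) 𝓘(ℝ, E) ∞ f)
    (u v : TangentSpace 𝓘(ℝ, F) p) :
    secondFundamentalForm covN covM f p u v = secondFundamentalForm covN covM f p v u := by
  rw [secondFundamentalForm, secondFundamentalForm, ambientDeriv_extend_comm hM hf,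
    cov_extend_comm hN]

variable [T2Space M]

/-- Covariant derivatives of coordinate fields with respect to a smooth connection are
differentiable at the centre of the chart. -/
lemma mdiffAt_cov_extend (hcov : CovariantDerivative.ContMDiffCovariantDerivative cov ∞) {x : M}
    (u v : TangentSpace 𝓘(ℝ, E) x) :
    MDiffAt (T% (fun y ↦ cov (extend E v) y (extend E u y))) x := by
  obtain ⟨s, hs, hsv⟩ := exists_contMDiffOn_extend (k := ∞) 𝓘(ℝ, E) E v
  obtain ⟨b, -, hb⟩ := (SmoothBumpFunction.nhds_basis_tsupport (I := 𝓘(ℝ, E)) x).mem_iff.1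
    (interior_mem_nhds.2 hs)
  -- Smoothness of the connection is applied to a globally smooth section, so the coordinate field
  -- is multiplied by a bump function equal to `1` near `x`; locality then removes the cut-off.
  have h1 : ContMDiff 𝓘(ℝ, E) (𝓘(ℝ, E).prod 𝓘(ℝ, E)) ∞
      (T% ((b : M → ℝ) • (extend E v : Π y : M, TangentSpace 𝓘(ℝ, E) y))) :=
    b.contMDiff.contMDiffOn.smul_section_of_tsupport isOpen_interior hb
      (hsv.mono interior_subset)
  have h2 := (contMDiffOn_univ.1 (hcov.contMDiff.contMDiff (h1.of_le
    (by simp)).contMDiffOn)).contMDiffAt (x := x)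
  have h3 := (h2.mdifferentiableAt (by simp)).clm_bundle_apply (mdiffAt_extend u)
  refine h3.congr_of_eventuallyEq ?_
  have hex : ∀ᶠ y in 𝓝 x, MDiffAt (T% (extend E v : Π y : M, TangentSpace 𝓘(ℝ, E) y)) y := by
    filter_upwards [interior_mem_nhds.2 hs] with y hy
    exact ((hsv y (interior_subset hy)).contMDiffAt
      (mem_interior_iff_mem_nhds.1 hy)).mdifferentiableAt (by simp)
  filter_upwards [b.eventuallyEq_one.eventuallyEq_nhds, hex] with y hy hy'
  have := cov_congr (Y := (b : M → ℝ) • (extend E v : Π y : M, TangentSpace 𝓘(ℝ, E) y)) cov hy'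
    (hy.mono fun z hz ↦ by simp [hz])
  rw [← this]

lemma mdiffAlong_cov_extend (hcov : CovariantDerivative.ContMDiffCovariantDerivative cov ∞)
    (hf : MDifferentiableAt 𝓘(ℝ, F) 𝓘(ℝ, E) f p) (u v : TangentSpace 𝓘(ℝ, E) (f p)) :
    MDiffAlong F E f (fun q ↦ cov (extend E v) (f q) (extend E u (f q))) p :=
  .comp (mdiffAt_cov_extend cov hcov u v) hf

end Along

/-! ### Second covariant derivatives and the curvature identity along a map. -/

section Curvature

variable {F : Type*} [NormedAddCommGroup F] [NormedSpace ℝ F] [FiniteDimensional ℝ F]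
  {N : Type*} [TopologicalSpace N] [ChartedSpace F N] [IsManifold 𝓘(ℝ, F) ∞ N]
  {E : Type*} [NormedAddCommGroup E] [NormedSpace ℝ E] [FiniteDimensional ℝ E]
  {M : Type*} [TopologicalSpace M] [ChartedSpace E M] [IsManifold 𝓘(ℝ, E) ∞ M]
variable {f : N → M} {p : N}
  (cov : CovariantDerivative 𝓘(ℝ, E) E (TangentSpace 𝓘(ℝ, E) : M → Type _))

lemma eventually_mdiffAt_extend {x : M} (v : TangentSpace 𝓘(ℝ, E) x) :
    ∀ᶠ y in 𝓝 x, MDiffAt (T% (extend E v : Π y : M, TangentSpace 𝓘(ℝ, E) y)) y := by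
  obtain ⟨s, hs, hsv⟩ := exists_contMDiffOn_extend (k := ∞) 𝓘(ℝ, E) E v
  filter_upwards [interior_mem_nhds.2 hs] with y hy
  exact ((hsv y (interior_subset hy)).contMDiffAt
    (mem_interior_iff_mem_nhds.1 hy)).mdifferentiableAt (by simp)

lemma eventually_cov_extend_add {x : M} (v w : TangentSpace 𝓘(ℝ, E) x) :
    ∀ᶠ y in 𝓝 x, cov (extend E (v + w)) y = cov (extend E v) y + cov (extend E w) y := by
  filter_upwards [(eventually_extend_add v w).eventually_nhds, eventually_mdiffAt_extend v,
    eventually_mdiffAt_extend w] with y hy hv hw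
  rw [← cov.isCovariantDerivativeOnUniv.add hv hw]
  exact cov_congr cov (mdifferentiableAt_add_section hv hw) hy

lemma eventually_cov_extend_smul {x : M} (c : ℝ) (v : TangentSpace 𝓘(ℝ, E) x) :
    ∀ᶠ y in 𝓝 x, cov (extend E (c • v)) y = c • cov (extend E v) y := by
  filter_upwards [(eventually_extend_smul c v).eventually_nhds, eventually_mdiffAt_extend v]
    with y hy hv
  rw [← cov.isCovariantDerivativeOnUniv.smul_const c hv]
  exact cov_congr cov hv.smul_const_section hy

/-- The value at `x` of `∇_X ∇_Y Z` for the coordinate fields `X`, `Y`, `Z` extending `u`, `v`,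
`w`. -/
def secondCov (x : M) (u v w : TangentSpace 𝓘(ℝ, E) x) : TangentSpace 𝓘(ℝ, E) x :=
  cov (fun y ↦ cov (extend E w) y (extend E v y)) x u

lemma curvature_eq_secondCov (x : M) (u v w : TangentSpace 𝓘(ℝ, E) x) :
    curvature cov x u v w = secondCov cov x u v w - secondCov cov x v u w := by
  simp only [curvature, mlieBracket_extend, map_zero, sub_zero, extend_apply_self, secondCov]

variable [T2Space M] {cov} (hcov : CovariantDerivative.ContMDiffCovariantDerivative cov ∞)
include hcov

/-- Here and in the next three lemmas, linearity over `ℝ` comes from that of `extend` near `x`. No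
tensoriality over functions is needed. -/
lemma secondCov_add_mid (x : M) (u v v' w : TangentSpace 𝓘(ℝ, E) x) :
    secondCov cov x u (v + v') w = secondCov cov x u v w + secondCov cov x u v' w := by
  have h1 := mdiffAt_cov_extend cov hcov v w
  have h2 := mdiffAt_cov_extend cov hcov v' w
  rw [secondCov, secondCov, secondCov, ← add_apply, ← cov.isCovariantDerivativeOnUniv.add h1 h2,
    cov_congr cov (mdifferentiableAt_add_section h1 h2)]
  filter_upwards [eventually_extend_add v v'] with y hy
  simp [hy]

lemma secondCov_smul_mid (x : M) (c : ℝ) (u v w : TangentSpace 𝓘(ℝ, E) x) :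
    secondCov cov x u (c • v) w = c • secondCov cov x u v w := by
  have h1 := mdiffAt_cov_extend cov hcov v w
  rw [secondCov, secondCov, ← smul_apply, ← cov.isCovariantDerivativeOnUniv.smul_const c h1,
    cov_congr cov h1.smul_const_section]
  filter_upwards [eventually_extend_smul c v] with y hy
  simp [hy]

lemma secondCov_add_right (x : M) (u v w w' : TangentSpace 𝓘(ℝ, E) x) :
    secondCov cov x u v (w + w') = secondCov cov x u v w + secondCov cov x u v w' := by
  have h1 := mdiffAt_cov_extend cov hcov v w
  have h2 := mdiffAt_cov_extend cov hcov v w'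
  rw [secondCov, secondCov, secondCov, ← add_apply, ← cov.isCovariantDerivativeOnUniv.add h1 h2,
    cov_congr cov (mdifferentiableAt_add_section h1 h2)]
  filter_upwards [eventually_cov_extend_add cov w w'] with y hy
  simp [hy]

lemma secondCov_smul_right (x : M) (c : ℝ) (u v w : TangentSpace 𝓘(ℝ, E) x) :
    secondCov cov x u v (c • w) = c • secondCov cov x u v w := by
  have h1 := mdiffAt_cov_extend cov hcov v w
  rw [secondCov, secondCov, ← smul_apply, ← cov.isCovariantDerivativeOnUniv.smul_const c h1,
    cov_congr cov h1.smul_const_section]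
  filter_upwards [eventually_cov_extend_smul cov c w] with y hy
  simp [hy]

lemma secondCov_sum_mid {ι : Type*} (s : Finset ι) (x : M) (a : ι → ℝ)
    (u : TangentSpace 𝓘(ℝ, E) x) (v : ι → TangentSpace 𝓘(ℝ, E) x) (w : TangentSpace 𝓘(ℝ, E) x) :
    secondCov cov x u (∑ i ∈ s, a i • v i) w = ∑ i ∈ s, a i • secondCov cov x u (v i) w := by
  classical
  induction s using Finset.induction_on with
  | empty => simpa using secondCov_smul_mid hcov x 0 u 0 w
  | insert i s hi ih =>
    rw [Finset.sum_insert hi, Finset.sum_insert hi, secondCov_add_mid hcov,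
      secondCov_smul_mid hcov, ih]

lemma curvature_add_right (x : M) (u v w w' : TangentSpace 𝓘(ℝ, E) x) :
    curvature cov x u v (w + w') = curvature cov x u v w + curvature cov x u v w' := by
  simp only [curvature_eq_secondCov, secondCov_add_right hcov]
  abel

lemma curvature_smul_right (x : M) (c : ℝ) (u v w : TangentSpace 𝓘(ℝ, E) x) :
    curvature cov x u v (c • w) = c • curvature cov x u v w := by
  simp only [curvature_eq_secondCov, secondCov_smul_right hcov, smul_sub]

omit hcov [T2Space M] in
variable (cov) in
lemma MDiffAlong.sum {ι : Type*} (s : Finset ι) {V : ι → Π q : N, TangentSpace 𝓘(ℝ, E) (f q)}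
    (hf : MDifferentiableAt 𝓘(ℝ, F) 𝓘(ℝ, E) f p) (hV : ∀ i, MDiffAlong F E f (V i) p) :
    MDiffAlong F E f (fun q ↦ ∑ i ∈ s, V i q) p ∧ ∀ u : TangentSpace 𝓘(ℝ, F) p,
      derivAlong cov f (fun q ↦ ∑ i ∈ s, V i q) p u = ∑ i ∈ s, derivAlong cov f (V i) p u := by
  classical
  induction s using Finset.induction_on with
  | empty => simpa using ⟨MDiffAlong.zero hf, derivAlong_zero cov hf⟩
  | insert i s hi ih =>
    simp only [Finset.sum_insert hi]
    refine ⟨(hV i).add ih.1, fun u ↦ ?_⟩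
    rw [derivAlong_add cov (hV i) ih.1, ih.2]

-- The chain rule holds at every `q` near `p`, and `df(v)` is expanded in the coordinate fields at
-- `f p`. The inner derivative thus becomes a combination of restricted ambient fields, ready to be
-- differentiated again.
omit hcov [T2Space M] in
lemma eventually_derivAlong_extend (hf : ContMDiff 𝓘(ℝ, F) 𝓘(ℝ, E) ∞ f)
    (w : TangentSpace 𝓘(ℝ, E) (f p)) (v : TangentSpace 𝓘(ℝ, F) p) :
    ∀ᶠ q in 𝓝 p, derivAlong cov f (fun q ↦ extend E w (f q)) q (extend F v q)
      = ∑ k, chartCoeff (f p) k (f q) (mfderiv 𝓘(ℝ, F) 𝓘(ℝ, E) f q (extend F v q)) •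
        cov (extend E w) (f q) (extend E (chartVec (f p) k) (f q)) := by
  have hfp : Filter.Tendsto f (𝓝 p) (𝓝 (f p)) := hf.continuous.continuousAt
  filter_upwards [eventually_mem_chartAt_source (E := E) hf.continuous.continuousAt,
    hfp.eventually (eventually_mdiffAt_extend w)] with q hq hq'
  rw [derivAlong_comp cov hq' (hf.mdifferentiable (by simp) q)]
  conv_lhs => rw [eq_sum_chartCoeff hq (mfderiv 𝓘(ℝ, F) 𝓘(ℝ, E) f q (extend F v q))]
  rw [map_sum]
  simp

/-- Leibniz on that expansion: the derivatives of the coefficients carry the second derivatives of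
`f` and are symmetric in `u`, `v`; the other terms add up to the ambient second covariant
derivative. -/
lemma derivAlong_derivAlong_extend (hf : ContMDiff 𝓘(ℝ, F) 𝓘(ℝ, E) ∞ f)
    (w : TangentSpace 𝓘(ℝ, E) (f p)) (v : TangentSpace 𝓘(ℝ, F) p) :
    MDiffAlong F E f
      (fun q ↦ derivAlong cov f (fun q ↦ extend E w (f q)) q (extend F v q)) p ∧
    ∀ u : TangentSpace 𝓘(ℝ, F) p,
      derivAlong cov f (fun q ↦ derivAlong cov f (fun q ↦ extend E w (f q)) q (extend F v q)) p u
      = ∑ k, d% (fun q ↦ chartCoeff (f p) k (f q)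
          (mfderiv 𝓘(ℝ, F) 𝓘(ℝ, E) f q (extend F v q))) p u •
            cov (extend E w) (f p) (chartVec (f p) k)
        + secondCov cov (f p) (mfderiv 𝓘(ℝ, F) 𝓘(ℝ, E) f p u)
          (mfderiv 𝓘(ℝ, F) 𝓘(ℝ, E) f p v) w := by
  have hfp : MDifferentiableAt 𝓘(ℝ, F) 𝓘(ℝ, E) f p := hf.mdifferentiable (by simp) p
  have h1 := eventually_derivAlong_extend (cov := cov) hf w v
  have h2 : ∀ k, MDiffAt (fun q ↦ chartCoeff (f p) k (f q)
      (mfderiv 𝓘(ℝ, F) 𝓘(ℝ, E) f q (extend F v q))) p := fun k ↦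
    (contMDiffAt_chartCoeff_mfderiv_extend hf v k).mdifferentiableAt (by simp)
  have h3 : ∀ k, MDiffAlong F E f (fun q ↦ cov (extend E w) (f q)
      (extend E (chartVec (f p) k) (f q))) p := fun k ↦ mdiffAlong_cov_extend cov hcov hfp _ _
  have h4 := MDiffAlong.sum cov Finset.univ hfp (fun k ↦ (h3 k).smul (h2 k))
  refine ⟨h4.1.congr h1, fun u ↦ ?_⟩
  rw [derivAlong_congr cov h1, h4.2]
  have h5 : ∀ k, derivAlong cov f (fun q ↦ cov (extend E w) (f q)
      (extend E (chartVec (f p) k) (f q))) p u = secondCov cov (f p)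
        (mfderiv 𝓘(ℝ, F) 𝓘(ℝ, E) f p u) (chartVec (f p) k) w := fun k ↦
    derivAlong_comp cov (mdiffAt_cov_extend cov hcov _ _) hfp u
  simp only [fun k ↦ derivAlong_smul cov (h2 k) (h3 k) u, h5, Finset.sum_add_distrib,
    extend_apply_self]
  rw [← secondCov_sum_mid hcov]
  congr 2
  conv_rhs => rw [eq_sum_chartCoeff (mem_chart_source E (f p)) (mfderiv 𝓘(ℝ, F) 𝓘(ℝ, E) f p v)]
  simp only [extend_apply_self]

/-- The curvature identity for second derivatives of vector fields along a map. -/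
theorem derivAlong_derivAlong_sub (hf : ContMDiff 𝓘(ℝ, F) 𝓘(ℝ, E) ∞ f)
    {V : Π q : N, TangentSpace 𝓘(ℝ, E) (f q)}
    (hV : ∀ k, ContMDiffAt 𝓘(ℝ, F) 𝓘(ℝ, ℝ) 2 (fun q ↦ chartCoeff (f p) k (f q) (V q)) p) :
    (∀ v : TangentSpace 𝓘(ℝ, F) p,
      MDiffAlong F E f (fun q ↦ derivAlong cov f V q (extend F v q)) p) ∧
    ∀ u v : TangentSpace 𝓘(ℝ, F) p,
      derivAlong cov f (fun q ↦ derivAlong cov f V q (extend F v q)) p u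
        - derivAlong cov f (fun q ↦ derivAlong cov f V q (extend F u q)) p v
      = curvature cov (f p) (mfderiv 𝓘(ℝ, F) 𝓘(ℝ, E) f p u)
          (mfderiv 𝓘(ℝ, F) 𝓘(ℝ, E) f p v) (V p) := by
  have hfd : ∀ q, MDifferentiableAt 𝓘(ℝ, F) 𝓘(ℝ, E) f q := hf.mdifferentiable (by simp)
  -- The predicate asks for differentiability near `p`, not only at `p`, since the inner derivative
  -- is taken at nearby points.
  refine (along_induction (p := p)
    (C := fun a ↦ ContMDiffAt 𝓘(ℝ, F) 𝓘(ℝ, ℝ) 2 a p)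
    (P := fun V ↦ (∀ᶠ q in 𝓝 p, MDiffAlong F E f V q) ∧
      (∀ v : TangentSpace 𝓘(ℝ, F) p,
        MDiffAlong F E f (fun q ↦ derivAlong cov f V q (extend F v q)) p) ∧
      ∀ u v : TangentSpace 𝓘(ℝ, F) p,
      derivAlong cov f (fun q ↦ derivAlong cov f V q (extend F v q)) p u
        - derivAlong cov f (fun q ↦ derivAlong cov f V q (extend F u q)) p v
      = curvature cov (f p) (mfderiv 𝓘(ℝ, F) 𝓘(ℝ, E) f p u)
          (mfderiv 𝓘(ℝ, F) 𝓘(ℝ, E) f p v) (V p))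
    ?_ ?_ ?_ ?_ ?_ hf.continuous.continuousAt hV).2
  · rintro V W h ⟨h1, h2, h3⟩
    have h4 : ∀ v : TangentSpace 𝓘(ℝ, F) p, ∀ᶠ q in 𝓝 p,
        derivAlong cov f W q (extend F v q) = derivAlong cov f V q (extend F v q) := fun v ↦
      h.eventually_nhds.mono fun q hq ↦ derivAlong_congr cov hq _
    refine ⟨?_, fun v ↦ (h2 v).congr (h4 v), fun u v ↦ ?_⟩
    · filter_upwards [h.eventually_nhds, h1] with q hq hq'
      exact hq'.congr hq
    · rw [derivAlong_congr cov (h4 v), derivAlong_congr cov (h4 u), h3, h.self_of_nhds]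
  · simp only [derivAlong_zero cov (hfd _)]
    refine ⟨.of_forall fun q ↦ .zero (hfd q), fun _ ↦ .zero (hfd p), fun u v ↦ ?_⟩
    have := curvature_smul_right hcov (f p) 0 (mfderiv 𝓘(ℝ, F) 𝓘(ℝ, E) f p u)
          (mfderiv 𝓘(ℝ, F) 𝓘(ℝ, E) f p v) 0
    simpa using this.symm
  · rintro V W ⟨h1, h2, h3⟩ ⟨k1, k2, k3⟩
    have h4 : ∀ v : TangentSpace 𝓘(ℝ, F) p, ∀ᶠ q in 𝓝 p,
        derivAlong cov f (fun q ↦ V q + W q) q (extend F v q)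
          = derivAlong cov f V q (extend F v q) + derivAlong cov f W q (extend F v q) := by
      intro v
      filter_upwards [h1, k1] with q hq hq'
      exact derivAlong_add cov hq hq' _
    refine ⟨?_, fun v ↦ ((h2 v).add (k2 v)).congr (h4 v), fun u v ↦ ?_⟩
    · filter_upwards [h1, k1] with q hq hq'
      exact hq.add hq'
    · rw [derivAlong_congr cov (h4 v), derivAlong_congr cov (h4 u),
        derivAlong_add cov (h2 v) (k2 v), derivAlong_add cov (h2 u) (k2 u),
        curvature_add_right hcov, ← h3, ← k3]
      abel
  -- The cross terms `da(u) D_v V + da(v) D_u V` are symmetric, and the second derivatives of `a`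
  -- commute as `a` is `C²`; only `a` times the curvature term remains.
  · rintro a V ha ⟨h1, h2, h3⟩
    have hae : ∀ᶠ q in 𝓝 p, MDiffAt a q := by
      filter_upwards [(contMDiffAt_iff_contMDiffAt_nhds (by simp)).1 ha] with q hq
      exact hq.mdifferentiableAt (by simp)
    have ha' : ∀ v : TangentSpace 𝓘(ℝ, F) p, MDiffAt (fun q ↦ d% a q (extend F v q)) p :=
      fun v ↦ (contMDiffAt_mvfderiv_extend (n := 1) ha v).mdifferentiableAt (by simp)
    have h4 : ∀ v : TangentSpace 𝓘(ℝ, F) p, ∀ᶠ q in 𝓝 p,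
        derivAlong cov f (fun q ↦ a q • V q) q (extend F v q)
          = d% a q (extend F v q) • V q + a q • derivAlong cov f V q (extend F v q) := by
      intro v
      filter_upwards [h1, hae] with q hq hq'
      exact derivAlong_smul cov hq' hq _
    have h1p := h1.self_of_nhds
    have hap := hae.self_of_nhds
    refine ⟨?_, fun v ↦ ((h1p.smul (ha' v)).add ((h2 v).smul hap)).congr (h4 v), fun u v ↦ ?_⟩
    · filter_upwards [h1, hae] with q hq hq'
      exact hq.smul hq'
    · rw [derivAlong_congr cov (h4 v), derivAlong_congr cov (h4 u),
        derivAlong_add cov (h1p.smul (ha' v)) ((h2 v).smul hap),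
        derivAlong_add cov (h1p.smul (ha' u)) ((h2 u).smul hap),
        derivAlong_smul cov (ha' v) h1p, derivAlong_smul cov (ha' u) h1p,
        derivAlong_smul cov hap (h2 v), derivAlong_smul cov hap (h2 u),
        curvature_smul_right hcov, ← h3, mvfderiv_extend_comm ha u v]
      simp only [extend_apply_self]
      module
  · intro w
    have hfp : Filter.Tendsto f (𝓝 p) (𝓝 (f p)) := hf.continuous.continuousAt
    refine ⟨?_, fun v ↦ (derivAlong_derivAlong_extend hcov hf w v).1, fun u v ↦ ?_⟩
    · filter_upwards [hfp.eventually (eventually_mdiffAt_extend w)] with q hq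
      exact .comp hq (hfd q)
    · rw [(derivAlong_derivAlong_extend hcov hf w v).2,
        (derivAlong_derivAlong_extend hcov hf w u).2, curvature_eq_secondCov]
      simp only [extend_apply_self, fun k ↦ mvfderiv_chartCoeff_mfderiv_extend_comm hf u v k]
      abel

end Curvature

/-! ### Dual connections along a map, and duality of their curvatures. -/

section Metric

variable {F : Type*} [NormedAddCommGroup F] [NormedSpace ℝ F] [FiniteDimensional ℝ F]
  {N : Type*} [TopologicalSpace N] [ChartedSpace F N] [IsManifold 𝓘(ℝ, F) ∞ N]
  {E : Type*} [NormedAddCommGroup E] [NormedSpace ℝ E] [FiniteDimensional ℝ E]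
  {M : Type*} [TopologicalSpace M] [ChartedSpace E M] [IsManifold 𝓘(ℝ, E) ∞ M]
  [RiemannianBundle (fun x : M ↦ TangentSpace 𝓘(ℝ, E) x)]
  [IsContMDiffRiemannianBundle 𝓘(ℝ, E) ∞ E (fun x : M ↦ TangentSpace 𝓘(ℝ, E) x)]

variable {f : N → M} {p : N}
  {cov cov' : CovariantDerivative 𝓘(ℝ, E) E (TangentSpace 𝓘(ℝ, E) : M → Type _)}

/-- Two affine connections are dual to each other:
`X g(Y, Z) = g(∇_X Y, Z) + g(Y, ∇*_X Z)`. -/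
def IsDualPair (cov cov' : CovariantDerivative 𝓘(ℝ, E) E (TangentSpace 𝓘(ℝ, E) : M → Type _)) :
    Prop :=
  ∀ (x : M) (Y Z : Π y : M, TangentSpace 𝓘(ℝ, E) y),
    MDiffAt (T% Y) x → MDiffAt (T% Z) x → ∀ u : TangentSpace 𝓘(ℝ, E) x,
      d% (fun y ↦ inner ℝ (Y y) (Z y)) x u
        = inner ℝ (cov Y x u) (Z x) + inner ℝ (Y x) (cov' Z x u)

lemma IsDualPair.symm (h : IsDualPair cov cov') : IsDualPair cov' cov := by
  intro x Y Z hY hZ u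
  have := h x Z Y hZ hY u
  simp only [real_inner_comm (Y _)] at this
  rw [this, add_comm, real_inner_comm (Z x), real_inner_comm (cov Z x u)]

lemma MDiffAlong.inner {V W : Π q : N, TangentSpace 𝓘(ℝ, E) (f q)} (hV : MDiffAlong F E f V p)
    (hW : MDiffAlong F E f W p) : MDiffAt (fun q ↦ inner ℝ (V q) (W q)) p :=
  MDifferentiableAt.inner_bundle (F := E) hV hW

lemma mdiffAt_inner {X Y : Π y : M, TangentSpace 𝓘(ℝ, E) y} {x : M} (hX : MDiffAt (T% X) x)
    (hY : MDiffAt (T% Y) x) : MDiffAt (fun y ↦ inner ℝ (X y) (Y y)) x :=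
  MDifferentiableAt.inner_bundle (F := E) hX hY

/-- Duality of two connections for the derivatives of vector fields along a map. -/
theorem IsDualPair.derivAlong (h : IsDualPair cov cov')
    {V W : Π q : N, TangentSpace 𝓘(ℝ, E) (f q)} (hV : MDiffAlong F E f V p)
    (hW : MDiffAlong F E f W p) (u : TangentSpace 𝓘(ℝ, F) p) :
    d% (fun q ↦ inner ℝ (V q) (W q)) p u
      = inner ℝ (derivAlong cov f V p u) (W p) + inner ℝ (V p) (derivAlong cov' f W p u) := by
  have hf := hV.base
  -- Two nested inductions: `W` is quantified inside the predicate for `V`, and is itself decomposed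
  -- once `V` is a coordinate field. For two coordinate fields the claim is duality on `M` and the
  -- chain rule.
  refine (along_induction (p := p) (C := fun a ↦ MDiffAt a p)
    (P := fun V ↦ MDiffAlong F E f V p ∧ ∀ W : Π q : N, TangentSpace 𝓘(ℝ, E) (f q),
      MDiffAlong F E f W p → d% (fun q ↦ inner ℝ (V q) (W q)) p u
      = inner ℝ (QuaternionStatistical.derivAlong cov f V p u) (W p)
        + inner ℝ (V p) (QuaternionStatistical.derivAlong cov' f W p u))
    ?_ ?_ ?_ ?_ ?_ hf.continuousAt hV.chartCoeff).2 W hW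
  · rintro V V' hVV ⟨h1, h2⟩
    refine ⟨h1.congr hVV, fun W hW ↦ ?_⟩
    rw [derivAlong_congr cov hVV, hVV.self_of_nhds, ← h2 W hW,
      mvfderiv_congr (k := fun q ↦ inner ℝ (V q) (W q)) (hVV.mono fun q hq ↦ by simp only [hq])]
  · refine ⟨.zero hf, fun W hW ↦ ?_⟩
    simp [derivAlong_zero cov hf, mvfderiv_const]
  · rintro V V' ⟨h1, h2⟩ ⟨h3, h4⟩
    refine ⟨h1.add h3, fun W hW ↦ ?_⟩
    simp only [inner_add_left]
    rw [mvfderiv_fun_add (h1.inner hW) (h3.inner hW), derivAlong_add cov h1 h3, inner_add_left,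
      add_apply, h2 W hW, h4 W hW]
    ring
  · rintro a V ha ⟨h1, h2⟩
    refine ⟨h1.smul ha, fun W hW ↦ ?_⟩
    simp only [real_inner_smul_left]
    rw [mvfderiv_fun_mul ha (h1.inner hW), derivAlong_smul cov ha h1, inner_add_left,
      add_apply, smul_apply, smul_apply, h2 W hW, real_inner_smul_left, real_inner_smul_left]
    simp only [smul_eq_mul]
    ring
  · intro v
    refine ⟨.extend_comp hf v, fun W hW ↦ ?_⟩
    refine (along_induction (p := p) (C := fun a ↦ MDiffAt a p)
      (P := fun W ↦ MDiffAlong F E f W p ∧ d% (fun q ↦ inner ℝ (extend E v (f q)) (W q)) p u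
      = inner ℝ (QuaternionStatistical.derivAlong cov f (fun q ↦ extend E v (f q)) p u) (W p)
        + inner ℝ (extend E v (f p)) (QuaternionStatistical.derivAlong cov' f W p u))
      ?_ ?_ ?_ ?_ ?_ hf.continuousAt hW.chartCoeff).2
    · rintro V V' hVV ⟨h1, h2⟩
      refine ⟨h1.congr hVV, ?_⟩
      rw [derivAlong_congr cov' hVV, hVV.self_of_nhds, ← h2,
        mvfderiv_congr (k := fun q ↦ inner ℝ (extend E v (f q)) (V q))
          (hVV.mono fun q hq ↦ by simp only [hq])]
    · refine ⟨.zero hf, ?_⟩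
      simp [derivAlong_zero cov' hf, mvfderiv_const]
    · rintro V V' ⟨h1, h2⟩ ⟨h3, h4⟩
      refine ⟨h1.add h3, ?_⟩
      have hv := MDiffAlong.extend_comp hf v
      simp only [inner_add_right]
      rw [mvfderiv_fun_add (hv.inner h1) (hv.inner h3), derivAlong_add cov' h1 h3,
        inner_add_right, add_apply, h2, h4]
      ring
    · rintro a V ha ⟨h1, h2⟩
      have hv := MDiffAlong.extend_comp hf v
      refine ⟨h1.smul ha, ?_⟩
      simp only [real_inner_smul_right]
      rw [mvfderiv_fun_mul ha (hv.inner h1), derivAlong_smul cov' ha h1, inner_add_right,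
        add_apply, smul_apply, smul_apply, h2, real_inner_smul_right, real_inner_smul_right]
      simp only [smul_eq_mul]
      ring
    · intro w
      refine ⟨.extend_comp hf w, ?_⟩
      rw [derivAlong_extend cov hf.continuousAt, derivAlong_extend cov' hf.continuousAt,
        ← h (f p) _ _ (mdiffAt_extend v) (mdiffAt_extend w)]
      have h5 : MDiffAt (fun y ↦ inner ℝ (extend E v y) (extend E w y)) (f p) :=
        mdiffAt_inner (mdiffAt_extend v) (mdiffAt_extend w)
      have h6 : d% (fun q ↦ inner ℝ (extend E v (f q)) (extend E w (f q))) p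
          = (d% (fun y ↦ inner ℝ (extend E v y) (extend E w y)) (f p)).comp
            (mfderiv 𝓘(ℝ, F) 𝓘(ℝ, E) f p) := mfderiv_comp p h5 hf
      rw [h6]
      rfl

lemma IsDualPair.mvfderiv_secondCov [T2Space M] (h : IsDualPair cov cov')
    (hcov : CovariantDerivative.ContMDiffCovariantDerivative cov ∞) {x : M}
    (u v w z : TangentSpace 𝓘(ℝ, E) x) :
    d% (fun y ↦ inner ℝ (cov (extend E w) y (extend E v y)) (extend E z y)) x u
      = inner ℝ (secondCov cov x u v w) z
        + inner ℝ (cov (extend E w) x v) (cov' (extend E z) x u) := by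
  rw [h x _ _ (mdiffAt_cov_extend cov hcov v w) (mdiffAt_extend z)]
  simp only [extend_apply_self, secondCov]

/-- The curvature tensors of dual connections are dual to each other. -/
theorem IsDualPair.curvature [T2Space M] (h : IsDualPair cov cov')
    (hcov : CovariantDerivative.ContMDiffCovariantDerivative cov ∞)
    (hcov' : CovariantDerivative.ContMDiffCovariantDerivative cov' ∞) {x : M}
    (u v w z : TangentSpace 𝓘(ℝ, E) x) :
    inner ℝ (curvature cov' x u v w) z = - inner ℝ w (curvature cov x u v z) := by
  -- The last bracket, with the products of first derivatives, is symmetric in `u`, `v`. Since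
  -- second derivatives of `g(W, Z)` commute, it drops out and the second covariant derivatives
  -- antisymmetrise to the two curvatures.
  have h1 : ∀ u v : TangentSpace 𝓘(ℝ, E) x,
      d% (fun y ↦ d% (fun y ↦ inner ℝ (extend E w y) (extend E z y)) y (extend E v y)) x u
      = inner ℝ (secondCov cov' x u v w) z + inner ℝ w (secondCov cov x u v z)
        + (inner ℝ (cov' (extend E w) x v) (cov (extend E z) x u)
          + inner ℝ (cov' (extend E w) x u) (cov (extend E z) x v)) := by
    intro u v
    have h2 : (fun y ↦ d% (fun y ↦ inner ℝ (extend E w y) (extend E z y)) y (extend E v y))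
        =ᶠ[𝓝 x] fun y ↦ inner ℝ (cov' (extend E w) y (extend E v y)) (extend E z y)
          + inner ℝ (cov (extend E z) y (extend E v y)) (extend E w y) := by
      filter_upwards [eventually_mdiffAt_extend w, eventually_mdiffAt_extend z] with y hw hz
      rw [h.symm y _ _ hw hz, real_inner_comm (extend E w y)]
    rw [mvfderiv_congr h2, mvfderiv_fun_add
      (mdiffAt_inner (mdiffAt_cov_extend cov' hcov' v w)
        (mdiffAt_extend z))
      (mdiffAt_inner (mdiffAt_cov_extend cov hcov v z)
        (mdiffAt_extend w)), add_apply, h.symm.mvfderiv_secondCov hcov',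
      h.mvfderiv_secondCov hcov, real_inner_comm w, real_inner_comm (cov' (extend E w) x u)]
    ring
  have h3 : ContMDiffAt 𝓘(ℝ, E) 𝓘(ℝ, ℝ) 2
      (fun y ↦ inner ℝ (extend E w y) (extend E z y)) x :=
    ContMDiffAt.inner_bundle (IB := 𝓘(ℝ, E)) (F := E) (contMDiffAt_extend ..)
      (contMDiffAt_extend ..)
  have h4 := mvfderiv_extend_comm h3 u v
  rw [h1, h1] at h4
  rw [curvature_eq_secondCov, curvature_eq_secondCov, inner_sub_left, inner_sub_right]
  linarith

end Metric

/-! ### The Gauss equation for dual connections. -/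

section Gauss

variable {F : Type*} [NormedAddCommGroup F] [NormedSpace ℝ F] [FiniteDimensional ℝ F]
  {N : Type*} [TopologicalSpace N] [ChartedSpace F N] [IsManifold 𝓘(ℝ, F) ∞ N]
  {E : Type*} [NormedAddCommGroup E] [NormedSpace ℝ E] [FiniteDimensional ℝ E]
  {M : Type*} [TopologicalSpace M] [ChartedSpace E M] [IsManifold 𝓘(ℝ, E) ∞ M]
  [RiemannianBundle (fun x : N ↦ TangentSpace 𝓘(ℝ, F) x)]
  [IsContMDiffRiemannianBundle 𝓘(ℝ, F) ∞ F (fun x : N ↦ TangentSpace 𝓘(ℝ, F) x)]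
  [RiemannianBundle (fun x : M ↦ TangentSpace 𝓘(ℝ, E) x)]
  [IsContMDiffRiemannianBundle 𝓘(ℝ, E) ∞ E (fun x : M ↦ TangentSpace 𝓘(ℝ, E) x)]

variable {f : N → M} {p : N}
  {covN covN' : CovariantDerivative 𝓘(ℝ, F) F (TangentSpace 𝓘(ℝ, F) : N → Type _)}
  {covM covM' : CovariantDerivative 𝓘(ℝ, E) E (TangentSpace 𝓘(ℝ, E) : M → Type _)}

/-- `∇_X Y` on the submanifold is the tangential component of the ambient derivative. -/
def IsTangentialPart (f : N → M)
    (covN : CovariantDerivative 𝓘(ℝ, F) F (TangentSpace 𝓘(ℝ, F) : N → Type _))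
    (covM : CovariantDerivative 𝓘(ℝ, E) E (TangentSpace 𝓘(ℝ, E) : M → Type _)) : Prop :=
  ∀ (p : N) (Y : Π q : N, TangentSpace 𝓘(ℝ, F) q), MDiffAt (T% Y) p →
    ∀ u : TangentSpace 𝓘(ℝ, F) p,
      ambientDeriv covM f Y p u - mfderiv 𝓘(ℝ, F) 𝓘(ℝ, E) f p (covN Y p u)
        ∈ normalSpace F E f p

lemma inner_mfderiv_of_mem_normalSpace {x : TangentSpace 𝓘(ℝ, E) (f p)}
    (hx : x ∈ normalSpace F E f p) (z : TangentSpace 𝓘(ℝ, F) p) :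
    inner ℝ x (mfderiv 𝓘(ℝ, F) 𝓘(ℝ, E) f p z) = 0 :=
  (Submodule.mem_orthogonal' _ _).1 hx _ ⟨z, rfl⟩

lemma IsTangentialPart.secondFundamentalForm_mem (h : IsTangentialPart f covN covM)
    (u v : TangentSpace 𝓘(ℝ, F) p) :
    secondFundamentalForm covN covM f p u v ∈ normalSpace F E f p :=
  h p _ (mdiffAt_extend v) u

variable [T2Space N] [T2Space M]

/-- Near `p`, `g(∇_Y W, Z)` equals the ambient product of `D_Y (df W)` with `df Z`, as the normal
part is invisible to `df Z`. Differentiating once more by duality, on `N` and along `f`, gives the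
formula. -/
lemma IsTangentialPart.inner_secondCov (h : IsTangentialPart f covN covM)
    (h' : IsTangentialPart f covN' covM') (hN : IsDualPair covN covN')
    (hM : IsDualPair covM covM')
    (hcovN : CovariantDerivative.ContMDiffCovariantDerivative covN ∞)
    (hcovM : CovariantDerivative.ContMDiffCovariantDerivative covM ∞)
    (hf : ContMDiff 𝓘(ℝ, F) 𝓘(ℝ, E) ∞ f)
    (hiso : ∀ (p : N) (u v : TangentSpace 𝓘(ℝ, F) p),
      inner ℝ (mfderiv 𝓘(ℝ, F) 𝓘(ℝ, E) f p u) (mfderiv 𝓘(ℝ, F) 𝓘(ℝ, E) f p v) = inner ℝ u v)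
    (u v w z : TangentSpace 𝓘(ℝ, F) p) :
    inner ℝ (secondCov covN p u v w) z
      = inner ℝ (derivAlong covM f (fun q ↦ derivAlong covM f
            (fun q ↦ mfderiv 𝓘(ℝ, F) 𝓘(ℝ, E) f q (extend F w q)) q (extend F v q)) p u)
          (mfderiv 𝓘(ℝ, F) 𝓘(ℝ, E) f p z)
        + inner ℝ (secondFundamentalForm covN covM f p v w)
          (secondFundamentalForm covN' covM' f p u z) := by
  have h1 : (fun q ↦ inner ℝ (covN (extend F w) q (extend F v q)) (extend F z q)) =ᶠ[𝓝 p]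
      fun q ↦ inner ℝ (derivAlong covM f
        (fun q ↦ mfderiv 𝓘(ℝ, F) 𝓘(ℝ, E) f q (extend F w q)) q (extend F v q))
        (mfderiv 𝓘(ℝ, F) 𝓘(ℝ, E) f q (extend F z q)) := by
    filter_upwards [eventually_mdiffAt_extend w] with q hq
    have := inner_mfderiv_of_mem_normalSpace (h q _ hq (extend F v q)) (extend F z q)
    rw [inner_sub_left, hiso, sub_eq_zero] at this
    exact this.symm
  have h2 := (derivAlong_derivAlong_sub hcovM hf
    (V := fun q ↦ mfderiv 𝓘(ℝ, F) 𝓘(ℝ, E) f q (extend F w q)) (p := p) fun k ↦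
    (contMDiffAt_chartCoeff_mfderiv_extend hf w k).of_le
      (WithTop.coe_le_coe.2 (le_top (a := (2 : ℕ∞))))).1 v
  have h3 := hM.derivAlong h2 (mdiffAlong_mfderiv_extend hf z) u
  rw [← mvfderiv_congr h1, hN.mvfderiv_secondCov hcovN] at h3
  simp only [extend_apply_self] at h3
  have h4 : derivAlong covM f (fun q ↦ mfderiv 𝓘(ℝ, F) 𝓘(ℝ, E) f q (extend F w q)) p v
      = mfderiv 𝓘(ℝ, F) 𝓘(ℝ, E) f p (covN (extend F w) p v)
        + secondFundamentalForm covN covM f p v w :=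
    (add_sub_cancel _ _).symm
  have h5 : derivAlong covM' f (fun q ↦ mfderiv 𝓘(ℝ, F) 𝓘(ℝ, E) f q (extend F z q)) p u
      = mfderiv 𝓘(ℝ, F) 𝓘(ℝ, E) f p (covN' (extend F z) p u)
        + secondFundamentalForm covN' covM' f p u z :=
    (add_sub_cancel _ _).symm
  -- After splitting into tangential and normal parts, the product of the tangential parts cancels
  -- the term from duality on `N`, and the product of the normal parts stays.
  rw [h4, h5, inner_add_left, inner_add_right, inner_add_right, hiso,
    inner_mfderiv_of_mem_normalSpace (h.secondFundamentalForm_mem v w), real_inner_comm _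
      (mfderiv 𝓘(ℝ, F) 𝓘(ℝ, E) f p (covN (extend F w) p v)),
    inner_mfderiv_of_mem_normalSpace (h'.secondFundamentalForm_mem u z)] at h3
  linarith

/-- The Gauss equation for a pair of dual connections. -/
theorem IsTangentialPart.gauss (h : IsTangentialPart f covN covM)
    (h' : IsTangentialPart f covN' covM') (hN : IsDualPair covN covN')
    (hM : IsDualPair covM covM')
    (hcovN : CovariantDerivative.ContMDiffCovariantDerivative covN ∞)
    (hcovM : CovariantDerivative.ContMDiffCovariantDerivative covM ∞)
    (hf : ContMDiff 𝓘(ℝ, F) 𝓘(ℝ, E) ∞ f)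
    (hiso : ∀ (p : N) (u v : TangentSpace 𝓘(ℝ, F) p),
      inner ℝ (mfderiv 𝓘(ℝ, F) 𝓘(ℝ, E) f p u) (mfderiv 𝓘(ℝ, F) 𝓘(ℝ, E) f p v) = inner ℝ u v)
    (u v w z : TangentSpace 𝓘(ℝ, F) p) :
    inner ℝ (curvature covN p u v w) z
      = inner ℝ (curvature covM (f p) (mfderiv 𝓘(ℝ, F) 𝓘(ℝ, E) f p u)
          (mfderiv 𝓘(ℝ, F) 𝓘(ℝ, E) f p v) (mfderiv 𝓘(ℝ, F) 𝓘(ℝ, E) f p w))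
          (mfderiv 𝓘(ℝ, F) 𝓘(ℝ, E) f p z)
        + inner ℝ (secondFundamentalForm covN covM f p v w)
          (secondFundamentalForm covN' covM' f p u z)
        - inner ℝ (secondFundamentalForm covN covM f p u w)
          (secondFundamentalForm covN' covM' f p v z) := by
  have h2 := (derivAlong_derivAlong_sub hcovM hf
    (V := fun q ↦ mfderiv 𝓘(ℝ, F) 𝓘(ℝ, E) f q (extend F w q)) (p := p) fun k ↦
    (contMDiffAt_chartCoeff_mfderiv_extend hf w k).of_le
      (WithTop.coe_le_coe.2 (le_top (a := (2 : ℕ∞))))).2 u v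
  simp only [extend_apply_self] at h2
  rw [curvature_eq_secondCov, inner_sub_left, ← h2, inner_sub_left,
    h.inner_secondCov h' hN hM hcovN hcovM hf hiso, h.inner_secondCov h' hN hM hcovN hcovM hf hiso]
  ring

end Gauss

/-! ### The curvature `K - K°` of one plane. -/

section Statistical

variable {F : Type*} [NormedAddCommGroup F] [NormedSpace ℝ F] [FiniteDimensional ℝ F]
  {N : Type*} [TopologicalSpace N] [ChartedSpace F N] [IsManifold 𝓘(ℝ, F) ∞ N]
  {E : Type*} [NormedAddCommGroup E] [NormedSpace ℝ E] [FiniteDimensional ℝ E]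
  {M : Type*} [TopologicalSpace M] [ChartedSpace E M] [IsManifold 𝓘(ℝ, E) ∞ M]
  [RiemannianBundle (fun x : N ↦ TangentSpace 𝓘(ℝ, F) x)]
  [IsContMDiffRiemannianBundle 𝓘(ℝ, F) ∞ F (fun x : N ↦ TangentSpace 𝓘(ℝ, F) x)]
  [RiemannianBundle (fun x : M ↦ TangentSpace 𝓘(ℝ, E) x)]
  [IsContMDiffRiemannianBundle 𝓘(ℝ, E) ∞ E (fun x : M ↦ TangentSpace 𝓘(ℝ, E) x)]
  {f : N → M} {S : StatisticalStructure F N} {T : StatisticalStructure E M}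

lemma StatisticalStructure.isDualPair (T : StatisticalStructure E M) :
    IsDualPair T.conn T.dual := T.duality

lemma StatisticalStructure.isDualPair_leviCivita (T : StatisticalStructure E M) :
    IsDualPair T.leviCivita T.leviCivita := by
  intro x Y Z hY hZ u
  have h1 := T.isDualPair x Y Z hY hZ u
  have h2 := T.isDualPair.symm x Y Z hY hZ u
  simp only [T.leviCivita_apply, inner_add_left, inner_add_right, real_inner_smul_left,
    real_inner_smul_right]
  linarith

lemma StatisticalStructure.smooth_leviCivita (T : StatisticalStructure E M) :
    CovariantDerivative.ContMDiffCovariantDerivative T.leviCivita ∞ :=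
  .affineCombination _ _ contMDiff_const T.smooth_conn T.smooth_dual

lemma StatisticalStructure.ambientDeriv_leviCivita (T : StatisticalStructure E M)
    (Y : Π q : N, TangentSpace 𝓘(ℝ, F) q) (p : N) (u : TangentSpace 𝓘(ℝ, F) p) :
    ambientDeriv T.leviCivita f Y p u
      = (1 / 2 : ℝ) • ambientDeriv T.conn f Y p u + (1 / 2 : ℝ) • ambientDeriv T.dual f Y p u := by
  simp only [ambientDeriv, derivAlong, T.leviCivita_apply]
  module

lemma secondFundamentalForm_leviCivita (p : N) (u v : TangentSpace 𝓘(ℝ, F) p) :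
    secondFundamentalForm S.leviCivita T.leviCivita f p u v
      = (1 / 2 : ℝ) • (secondFundamentalForm S.conn T.conn f p u v
        + secondFundamentalForm S.dual T.dual f p u v) := by
  simp only [secondFundamentalForm, T.ambientDeriv_leviCivita, S.leviCivita_apply, map_add,
    map_smul]
  module

lemma IsStatisticalSubmanifold.leviCivita (hf : IsStatisticalSubmanifold f S T) :
    IsTangentialPart f S.leviCivita T.leviCivita := by
  intro p Y hY u
  have h1 := Submodule.smul_mem _ (1 / 2 : ℝ) (hf.tangential_conn p Y hY u)
  have h2 := Submodule.smul_mem _ (1 / 2 : ℝ) (hf.tangential_dual p Y hY u)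
  convert Submodule.add_mem _ h1 h2 using 1
  simp only [T.ambientDeriv_leviCivita, S.leviCivita_apply, map_add, map_smul]
  module

variable [T2Space N] [T2Space M] {Q : AlmostQuaternionStructure E M} {c : ℝ} {p : N} {U : Set M}
    {J : Fin 3 → Π x : M, TangentSpace 𝓘(ℝ, E) x →L[ℝ] TangentSpace 𝓘(ℝ, E) x}

/-- The difference `K - K°` of the two sectional curvatures of a statistical submanifold of a
quaternion Kaehler-like statistical manifold. -/
theorem sectionalK_sub_sectionalLC (hf : IsStatisticalSubmanifold f S T)
    (hT : IsQuaternionKaehlerLike T Q c) (hU : f p ∈ U) (hJ : IsCanonicalBasis E M Q.Λ U J)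
    {u v : TangentSpace 𝓘(ℝ, F) p} (hu : inner ℝ u u = (1 : ℝ)) (hv : inner ℝ v v = (1 : ℝ))
    (huv : inner ℝ u v = (0 : ℝ)) :
    letI d := mfderiv 𝓘(ℝ, F) 𝓘(ℝ, E) f p
    letI j : Fin 3 → TangentSpace 𝓘(ℝ, F) p → TangentSpace 𝓘(ℝ, F) p → ℝ :=
      fun α a b ↦ inner ℝ (d a) (J α (f p) (d b))
    letI σ := secondFundamentalForm S.conn T.conn f p
    letI σ' := secondFundamentalForm S.dual T.dual f p
    S.sectionalK p u v - S.sectionalLC p u v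
      = c / 4 * (1 + ∑ α, (j α u u * j α v v - 2 * (j α u v * j α v u)
          + (1 / 2) * j α u v ^ 2 + (1 / 2) * j α v u ^ 2))
        - 2 * T.sectionalLC (f p) (d u) (d v)
        + (1 / 2) * (inner ℝ (σ u v) (σ u v) - inner ℝ (σ u u) (σ v v))
        + (1 / 2) * (inner ℝ (σ' u v) (σ' u v) - inner ℝ (σ' u u) (σ' v v)) := by
  have h1 : IsTangentialPart f S.conn T.conn := hf.tangential_conn
  have h2 : IsTangentialPart f S.dual T.dual := hf.tangential_dual
  have g1 := h1.gauss h2 S.isDualPair T.isDualPair S.smooth_conn T.smooth_conn hf.smooth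
    hf.isometric u v v u
  have g2 := h2.gauss h1 S.isDualPair.symm T.isDualPair.symm S.smooth_dual T.smooth_dual hf.smooth
    hf.isometric u v v u
  have g3 := hf.leviCivita.gauss hf.leviCivita S.isDualPair_leviCivita T.isDualPair_leviCivita
    S.smooth_leviCivita T.smooth_leviCivita hf.smooth hf.isometric u v v u
  -- Only the curvature of `∇` is prescribed. Duality contributes the square of `g(v, J_α u)` where
  -- `∇` contributes that of `g(u, J_α v)`; averaging gives both the weight `1/2`.
  rw [T.isDualPair.curvature T.smooth_conn T.smooth_dual] at g2
  rw [hT.curvature_eq U J hJ _ hU] at g1 g2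
  simp only [StatisticalStructure.sectionalK, StatisticalStructure.sectionalLC]
  rw [g1, g2, g3, secondFundamentalForm_comm S.torsion_conn T.torsion_conn hf.smooth v u,
    secondFundamentalForm_comm S.torsion_dual T.torsion_dual hf.smooth v u]
  simp only [secondFundamentalForm_leviCivita]
  rw [secondFundamentalForm_comm S.torsion_conn T.torsion_conn hf.smooth v u,
    secondFundamentalForm_comm S.torsion_dual T.torsion_dual hf.smooth v u]
  have hvu : inner ℝ v u = (0 : ℝ) := by rw [real_inner_comm, huv]
  simp only [inner_add_left, inner_add_right, inner_sub_left, inner_sub_right,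
    real_inner_smul_left, real_inner_smul_right, hf.isometric, hu, hv, huv, hvu,
    Fin.sum_univ_three]
  have hs : ∀ α (a b : TangentSpace 𝓘(ℝ, F) p),
      inner ℝ (J α (f p) (mfderiv 𝓘(ℝ, F) 𝓘(ℝ, E) f p a)) (mfderiv 𝓘(ℝ, F) 𝓘(ℝ, E) f p b)
        = inner ℝ (mfderiv 𝓘(ℝ, F) 𝓘(ℝ, E) f p b)
          (J α (f p) (mfderiv 𝓘(ℝ, F) 𝓘(ℝ, E) f p a)) := fun _ _ _ ↦ real_inner_comm _ _
  have hσ : ∀ a b a' b' : TangentSpace 𝓘(ℝ, F) p,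
      inner ℝ (secondFundamentalForm S.dual T.dual f p a b)
        (secondFundamentalForm S.conn T.conn f p a' b')
        = inner ℝ (secondFundamentalForm S.conn T.conn f p a' b')
        (secondFundamentalForm S.dual T.dual f p a b) := fun _ _ _ _ ↦ real_inner_comm _ _
  simp only [hs, hσ]
  rw [real_inner_comm (secondFundamentalForm S.conn T.conn f p u u)
      (secondFundamentalForm S.conn T.conn f p v v),
    real_inner_comm (secondFundamentalForm S.dual T.dual f p u u)
      (secondFundamentalForm S.dual T.dual f p v v)]
  -- All products of `σ` with `σ*` cancel here.
  ring

end Statistical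

/-! ### Sums over pairs `i < j`. -/

section PairSums

variable {n : ℕ}

/-- The pairs `(i, j)` with `i < j`. -/
def orderedPairs (n : ℕ) : Finset (Fin n × Fin n) := {q | q.1 < q.2}

lemma mem_orderedPairs {q : Fin n × Fin n} : q ∈ orderedPairs n ↔ q.1 < q.2 := by
  simp [orderedPairs]

lemma sum_sum_ite_lt (g : Fin n → Fin n → ℝ) :
    ∑ i, ∑ j, (if i < j then g i j else 0) = ∑ q ∈ orderedPairs n, g q.1 q.2 := by
  rw [orderedPairs, Finset.sum_filter, Fintype.sum_prod_type]

lemma two_mul_sum_orderedPairs {g : Fin n → Fin n → ℝ} (hg : ∀ i j, g i j = g j i) :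
    2 * ∑ q ∈ orderedPairs n, g q.1 q.2 + ∑ i, g i i = ∑ i, ∑ j, g i j := by
  have h : ∀ i j, g i j = (if i < j then g i j else 0) + (if j < i then g j i else 0)
      + (if i = j then g i j else 0) := by
    intro i j
    rcases lt_trichotomy i j with h | h | h
    · simp [h, h.ne, h.not_gt]
    · simp [h]
    · simp [h, h.ne', h.not_gt, hg i j]
  rw [Finset.sum_congr rfl fun i _ ↦ Finset.sum_congr rfl fun j _ ↦ h i j]
  simp only [Finset.sum_add_distrib]
  rw [Finset.sum_comm (f := fun i j ↦ if j < i then g j i else 0), sum_sum_ite_lt]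
  simp only [Finset.sum_ite_eq, Finset.mem_univ, if_true]
  ring

lemma two_mul_sum_orderedPairs_mul (a : Fin n → ℝ) :
    2 * ∑ q ∈ orderedPairs n, a q.1 * a q.2 + ∑ i, a i ^ 2 = (∑ i, a i) ^ 2 := by
  have := two_mul_sum_orderedPairs (g := fun i j ↦ a i * a j) fun i j ↦ mul_comm _ _
  simp only [← pow_two, ← Finset.mul_sum, ← Finset.sum_mul] at this
  exact this

lemma two_mul_card_orderedPairs (n : ℕ) :
    2 * ∑ _q ∈ orderedPairs n, (1 : ℝ) = n * (n - 1) := by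
  have := two_mul_sum_orderedPairs_mul (n := n) fun _ ↦ 1
  simp only [mul_one, one_pow, Finset.sum_const, Finset.card_univ, Fintype.card_fin,
    nsmul_eq_mul] at this ⊢
  linarith

lemma sum_orderedPairs_bilin (j : Fin n → Fin n → ℝ) :
    ∑ q ∈ orderedPairs n, (j q.1 q.1 * j q.2 q.2 - 2 * (j q.1 q.2 * j q.2 q.1)
        + (1 / 2) * j q.1 q.2 ^ 2 + (1 / 2) * j q.2 q.1 ^ 2)
      = (1 / 2) * (∑ i, j i i) ^ 2 + (1 / 2) * ∑ i, ∑ k, j k i ^ 2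
        - ∑ i, ∑ k, j i k * j k i := by
  have := two_mul_sum_orderedPairs (g := fun a b ↦ j a a * j b b - 2 * (j a b * j b a)
        + (1 / 2) * j a b ^ 2 + (1 / 2) * j b a ^ 2) fun a b ↦ by ring
  -- On the diagonal the coefficients add up to `1 - 2 + 1/2 + 1/2 = 0`, so the pair sum is exactly
  -- half of the full double sum.
  have h0 : ∑ i, (j i i * j i i - 2 * (j i i * j i i)
        + (1 / 2) * j i i ^ 2 + (1 / 2) * j i i ^ 2) = 0 :=
    Finset.sum_eq_zero fun i _ ↦ by ring
  have h1 : ∑ a, ∑ b, j a b ^ 2 = ∑ a, ∑ b, j b a ^ 2 := Finset.sum_comm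
  rw [h0] at this
  simp only [Finset.sum_add_distrib, Finset.sum_sub_distrib, ← Finset.mul_sum,
    ← Finset.sum_mul] at this
  rw [h1] at this
  simp only [Finset.sum_add_distrib, Finset.sum_sub_distrib, ← Finset.mul_sum]
  linarith

end PairSums

/-! ### Chen's algebraic inequality. -/

section Chen

/-- Chen's inequality for the diagonal entries of a second fundamental form. -/
lemma chen_inequality {n : ℕ} (hn : 2 ≤ n) {i₁ i₂ : Fin n} (h₁ : (i₁ : ℕ) = 0) (h₂ : (i₂ : ℕ) = 1)
    (a : Fin n → ℝ) :
    letI r : ℝ := ((n : ℝ) - 2) / (2 * (n - 1)) * (∑ i, a i) ^ 2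
    ∑ q ∈ orderedPairs n, a q.1 * a q.2 - a i₁ * a i₂ ≤ r ∧
      (∑ q ∈ orderedPairs n, a q.1 * a q.2 - a i₁ * a i₂ = r ↔
        ∀ k : Fin n, 2 ≤ (k : ℕ) → a i₁ + a i₂ = a k) := by
  obtain ⟨t, rfl⟩ := Nat.exists_eq_add_of_le' hn
  obtain rfl : i₁ = 0 := Fin.ext h₁
  obtain rfl : i₂ = 1 := Fin.ext h₂
  have h := two_mul_sum_orderedPairs_mul a
  have hk : (∀ k : Fin (t + 2), 2 ≤ (k : ℕ) → a 0 + a 1 = a k) ↔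
      ∀ k : Fin t, a 0 + a 1 = a k.succ.succ := by
    refine ⟨fun h k ↦ h _ (by simp), fun h k hk ↦ ?_⟩
    obtain ⟨k, rfl⟩ := Fin.exists_succ_eq_of_ne_zero (x := k) (by rintro rfl; simp at hk)
    obtain ⟨k, rfl⟩ := Fin.exists_succ_eq_of_ne_zero (x := k) (by rintro rfl; simp at hk)
    exact h k
  change ∑ q ∈ orderedPairs (t + 2), a q.1 * a q.2 - a 0 * a 1 ≤ _ ∧
      (∑ q ∈ orderedPairs (t + 2), a q.1 * a q.2 - a 0 * a 1 = _ ↔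
        ∀ k : Fin (t + 2), 2 ≤ (k : ℕ) → a 0 + a 1 = a k)
  rw [hk]
  set p := ∑ q ∈ orderedPairs (t + 2), a q.1 * a q.2
  simp only [Fin.sum_univ_succ, Fin.succ_zero_eq_one] at h ⊢
  set x := a 0 + a 1 with hx
  set b : Fin t → ℝ := fun k ↦ a k.succ.succ
  change 2 * p + (_ + (_ + ∑ k, b k ^ 2)) = (_ + (_ + ∑ k, b k)) ^ 2 at h
  change p - _ ≤ _ * (_ + (_ + ∑ k, b k)) ^ 2 ∧ (p - _ = _ * (_ + (_ + ∑ k, b k)) ^ 2 ↔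
    ∀ k, x = b k)
  have hB : (∑ k, b k) ^ 2 ≤ t * ∑ k, b k ^ 2 := by
    simpa using sq_sum_le_card_mul_sum_sq (s := Finset.univ) (f := b)
  have hsum : ∑ k, (x - b k) ^ 2 = t * x ^ 2 - 2 * x * ∑ k, b k + ∑ k, b k ^ 2 := by
    simp only [sub_sq, Finset.sum_add_distrib, Finset.sum_sub_distrib, ← Finset.mul_sum]
    simp
  have hpos : 0 ≤ ∑ k, (x - b k) ^ 2 := Finset.sum_nonneg fun k _ ↦ sq_nonneg _
  have hzero : ∑ k, (x - b k) ^ 2 = 0 ↔ ∀ k, x = b k := by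
    rw [Finset.sum_eq_zero_iff_of_nonneg fun k _ ↦ sq_nonneg _]
    simp [sub_eq_zero]
  have ht : (0 : ℝ) < t + 1 := by positivity
  -- With `n = t + 2`, `x = a 0 + a 1` and `b` the other entries, the defect times `2(n - 1)` is the
  -- sum of the squares `(x - b k)²` plus the Cauchy–Schwarz defect of `b`. Vanishing of the first
  -- makes `b` constant, so the second vanishes as well.
  have key : 2 * (t + 1) * (((t + 2 : ℕ) - 2 : ℝ) / (2 * ((t + 2 : ℕ) - 1))
        * (a 0 + (a 1 + ∑ k, b k)) ^ 2 - (p - a 0 * a 1))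
      = ∑ k, (x - b k) ^ 2 + (t * ∑ k, b k ^ 2 - (∑ k, b k) ^ 2) := by
    have h' : p = ((a 0 + (a 1 + ∑ k, b k)) ^ 2
      - (a 0 ^ 2 + (a 1 ^ 2 + ∑ k, b k ^ 2))) / 2 := by linarith
    rw [hsum, h', hx]
    push_cast
    have : (t : ℝ) + 2 - 1 = t + 1 := by ring
    rw [this]
    field_simp
    ring
  refine ⟨?_, ?_⟩
  · have : 0 ≤ 2 * ((t : ℝ) + 1) * (((t + 2 : ℕ) - 2 : ℝ) / (2 * ((t + 2 : ℕ) - 1))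
        * (a 0 + (a 1 + ∑ k, b k)) ^ 2 - (p - a 0 * a 1)) := by rw [key]; linarith
    exact sub_nonneg.1 (nonneg_of_mul_nonneg_right this (by positivity))
  · rw [← hzero]
    refine ⟨fun he ↦ ?_, fun he ↦ ?_⟩
    · rw [he, sub_self, mul_zero] at key
      linarith
    · have hb : ∑ k, b k = t * x := by
        rw [Finset.sum_congr rfl fun k _ ↦ (hzero.1 he k).symm]; simp
      have hb2 : ∑ k, b k ^ 2 = t * x ^ 2 := by
        rw [Finset.sum_congr rfl fun k _ ↦ by rw [← hzero.1 he k]]; simp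
      rw [he, hb, hb2] at key
      have : 2 * ((t : ℝ) + 1) * (((t + 2 : ℕ) - 2 : ℝ) / (2 * ((t + 2 : ℕ) - 1))
        * (a 0 + (a 1 + t * x)) ^ 2 - (p - a 0 * a 1)) = 0 := by rw [key]; ring
      rw [hb]
      rcases mul_eq_zero.1 this with h0 | h0
      · exact absurd h0 (by positivity)
      · linarith

/-- Subtracting the square at `(a, b)` erases one term from a sum of squares; symmetry extends the
vanishing to pairs in the opposite order. -/
lemma sum_orderedPairs_sq_sub {n : ℕ} (s : Fin n → Fin n → ℝ) (hs : ∀ i j, s i j = s j i)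
    {a b : Fin n} (hab : a < b) :
    0 ≤ ∑ q ∈ orderedPairs n, s q.1 q.2 ^ 2 - s a b ^ 2 ∧
      (∑ q ∈ orderedPairs n, s q.1 q.2 ^ 2 - s a b ^ 2 = 0 ↔
        ∀ k l : Fin n, k ≠ l → ¬ (k = a ∧ l = b) → ¬ (k = b ∧ l = a) → s k l = 0) := by
  have h := Finset.sum_erase_eq_sub (f := fun q : Fin n × Fin n ↦ s q.1 q.2 ^ 2)
    (mem_orderedPairs (q := (a, b)).2 hab)
  dsimp only at h
  rw [← h, Finset.sum_eq_zero_iff_of_nonneg fun _ _ ↦ sq_nonneg _]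
  refine ⟨Finset.sum_nonneg fun _ _ ↦ sq_nonneg _, fun h0 ↦ ?_, fun h0 q hq ↦ ?_⟩
  · have h1 : ∀ k l, k < l → ¬ (k = a ∧ l = b) → s k l = 0 := fun k l hkl hne ↦
      pow_eq_zero_iff two_ne_zero |>.1 (h0 (k, l) (by simpa [mem_orderedPairs, hkl] using hne))
    intro k l hkl hne hne'
    rcases hkl.lt_or_gt with hlt | hlt
    · exact h1 k l hlt hne
    · rw [hs]
      exact h1 l k hlt fun h ↦ hne' h.symm
  · rw [Finset.mem_erase, mem_orderedPairs] at hq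
    rw [h0 q.1 q.2 hq.2.ne (fun h ↦ hq.1 (Prod.ext h.1 h.2)) ?_, zero_pow two_ne_zero]
    rintro ⟨h1, h2⟩
    exact absurd hq.2 (by rw [h1, h2]; exact hab.not_gt)

/-- Chen's inequality for a symmetric bilinear form in components, with its equality case. -/
lemma chen_inequality_symm {n : ℕ} (hn : 2 ≤ n)
    {i₁ i₂ : Fin n} (h₁ : (i₁ : ℕ) = 0) (h₂ : (i₂ : ℕ) = 1)
    (s : Fin n → Fin n → ℝ)
    (hs : ∀ i j, s i j = s j i) :
    letI δ : ℝ := ((n : ℝ) - 2) / (2 * (n - 1)) * (∑ i, s i i) ^ 2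
      + (∑ q ∈ orderedPairs n, (s q.1 q.2 * s q.1 q.2 - s q.1 q.1 * s q.2 q.2)
        - (s i₁ i₂ * s i₁ i₂ - s i₁ i₁ * s i₂ i₂))
    0 ≤ δ ∧ (δ = 0 ↔ (∀ k : Fin n, 2 ≤ (k : ℕ) → s i₁ i₁ + s i₂ i₂ = s k k) ∧
      ∀ k l : Fin n, k ≠ l → ¬ (k = i₁ ∧ l = i₂) → ¬ (k = i₂ ∧ l = i₁) → s k l = 0) := by
  obtain ⟨h1, h2⟩ := chen_inequality hn h₁ h₂ fun i ↦ s i i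
  obtain ⟨h3, h4⟩ := sum_orderedPairs_sq_sub s hs
    (show i₁ < i₂ from Fin.lt_def.2 (by omega))
  rw [← h2, ← h4]
  simp only [Finset.sum_sub_distrib, ← pow_two]
  refine ⟨by linarith, fun h ↦ ⟨by linarith, by linarith⟩, fun h ↦ by linarith [h.1, h.2]⟩

end Chen

/-! ### Chen's inequality for normal-valued forms. -/

section Vectors

variable {W : Type*} [NormedAddCommGroup W] [InnerProductSpace ℝ W] {ι : Type*} [Fintype ι]
  {V : Submodule ℝ W}

lemma inner_eq_sum_orthonormalBasis (ξ : OrthonormalBasis ι ℝ V) {x y : W} (hx : x ∈ V)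
    (hy : y ∈ V) :
    inner ℝ x y = ∑ γ, inner ℝ x (ξ γ : W) * inner ℝ y (ξ γ : W) := by
  have := ξ.sum_inner_mul_inner ⟨x, hx⟩ ⟨y, hy⟩
  simp only [Submodule.coe_inner] at this
  rw [← this]
  exact Finset.sum_congr rfl fun γ _ ↦ by rw [real_inner_comm y]

/-- Chen's inequality for a symmetric vector valued bilinear form in components. -/
lemma chen_inequality_vector {n : ℕ} (hn : 2 ≤ n)
    {i₁ i₂ : Fin n} (h₁ : (i₁ : ℕ) = 0) (h₂ : (i₂ : ℕ) = 1)
    {X : Type*} (σ : X → X → W) (e : Fin n → X)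
    (hV : ∀ u v, σ u v ∈ V) (hs : ∀ u v, σ u v = σ v u) (ξ : OrthonormalBasis ι ℝ V) :
    letI g : Fin n → Fin n → ℝ := fun i j ↦
      (1 / 2) * (inner ℝ (σ (e i) (e j)) (σ (e i) (e j))
        - inner ℝ (σ (e i) (e i)) (σ (e j) (e j)))
    letI δ : ℝ := (n : ℝ) ^ 2 * (n - 2) / (4 * (n - 1)) * ‖meanCurvature σ e‖ ^ 2
      + (∑ q ∈ orderedPairs n, g q.1 q.2 - g i₁ i₂)
    0 ≤ δ ∧ (δ = 0 ↔ ∀ γ, (∀ k : Fin n, 2 ≤ (k : ℕ) →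
        inner ℝ (σ (e i₁) (e i₁)) (ξ γ : W) + inner ℝ (σ (e i₂) (e i₂)) (ξ γ : W)
          = inner ℝ (σ (e k) (e k)) (ξ γ : W)) ∧
      ∀ k l : Fin n, k ≠ l → ¬ (k = i₁ ∧ l = i₂) → ¬ (k = i₂ ∧ l = i₁) →
        inner ℝ (σ (e k) (e l)) (ξ γ : W) = 0) := by
  have hγ := fun γ ↦ chen_inequality_symm hn h₁ h₂ (fun i j ↦ inner ℝ (σ (e i) (e j)) (ξ γ : W))
    fun i j ↦ by rw [hs]
  dsimp only at hγ ⊢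
  have hH : (n : ℝ) ^ 2 * ‖meanCurvature σ e‖ ^ 2
      = ∑ γ, (∑ i, inner ℝ (σ (e i) (e i)) (ξ γ : W)) ^ 2 := by
    have hn0 : (n : ℝ) ≠ 0 := by positivity
    have hmem : ∑ i, σ (e i) (e i) ∈ V := Submodule.sum_mem _ fun i _ ↦ hV _ _
    rw [meanCurvature, norm_smul, mul_pow, ← real_inner_self_eq_norm_sq (∑ i, σ (e i) (e i)),
      inner_eq_sum_orthonormalBasis ξ hmem hmem]
    simp only [sum_inner, ← pow_two, Real.norm_eq_abs, sq_abs]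
    field_simp
  -- The scalar constant `(n - 2) / (2(n - 1))` is halved because `σ` enters `K - K°` with the
  -- factor `1/2`; the factor `n²` undoes the normalisation of the mean curvature.
  have key : (n : ℝ) ^ 2 * (n - 2) / (4 * (n - 1)) * ‖meanCurvature σ e‖ ^ 2
      = (1 / 2) * ∑ γ, ((n : ℝ) - 2) / (2 * (n - 1))
        * (∑ i, inner ℝ (σ (e i) (e i)) (ξ γ : W)) ^ 2 := by
    rw [← Finset.mul_sum, ← hH]
    have h1 : (n : ℝ) - 1 ≠ 0 := by
      have : (2 : ℝ) ≤ n := by exact_mod_cast hn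
      linarith
    field_simp
    ring
  have hg : ∀ i j, (1 / 2 : ℝ) * (inner ℝ (σ (e i) (e j)) (σ (e i) (e j))
        - inner ℝ (σ (e i) (e i)) (σ (e j) (e j)))
      = (1 / 2) * ∑ γ, (inner ℝ (σ (e i) (e j)) (ξ γ : W) * inner ℝ (σ (e i) (e j)) (ξ γ : W)
        - inner ℝ (σ (e i) (e i)) (ξ γ : W) * inner ℝ (σ (e j) (e j)) (ξ γ : W)) := by
    intro i j
    rw [inner_eq_sum_orthonormalBasis ξ (hV _ _) (hV _ _),
      inner_eq_sum_orthonormalBasis ξ (hV (e i) (e i)) (hV _ _), Finset.sum_sub_distrib]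
  simp only [hg]
  rw [key, ← Finset.mul_sum (s := orderedPairs n), Finset.sum_comm, ← mul_sub,
    ← mul_add, ← Finset.sum_sub_distrib, ← Finset.sum_add_distrib]
  refine ⟨mul_nonneg (by norm_num) (Finset.sum_nonneg fun γ _ ↦ (hγ γ).1), ?_⟩
  rw [mul_eq_zero, Finset.sum_eq_zero_iff_of_nonneg fun γ _ ↦ (hγ γ).1]
  simp only [(hγ _).2, one_div, inv_eq_zero, OfNat.ofNat_ne_zero, false_or, Finset.mem_univ,
    true_imp_iff]

end Vectors

/-! ### Traces in an orthonormal basis. -/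

section Traces

variable {X W : Type*} [NormedAddCommGroup X] [InnerProductSpace ℝ X] [NormedAddCommGroup W]
  [InnerProductSpace ℝ W] {ι : Type*} [Fintype ι]

lemma trace_comp_eq_sum_inner (e : OrthonormalBasis ι ℝ X) (P R : X →ₗ[ℝ] X) :
    LinearMap.trace ℝ X (P ∘ₗ R) = ∑ i, ∑ k, inner ℝ (e i) (P (e k)) * inner ℝ (e k) (R (e i)) := by
  classical
  rw [LinearMap.trace_eq_sum_inner _ e]
  refine Finset.sum_congr rfl fun i _ ↦ ?_
  conv_lhs => rw [LinearMap.comp_apply, ← e.sum_repr' (R (e i)), map_sum, inner_sum]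
  exact Finset.sum_congr rfl fun k _ ↦ by rw [map_smul, real_inner_smul_right, mul_comm]

end Traces

/-! ### Summation to the scalar curvatures. -/

section ScalarCurvature

variable {F : Type*} [NormedAddCommGroup F] [NormedSpace ℝ F] [FiniteDimensional ℝ F]
  {N : Type*} [TopologicalSpace N] [ChartedSpace F N] [IsManifold 𝓘(ℝ, F) ∞ N]
  {E : Type*} [NormedAddCommGroup E] [NormedSpace ℝ E] [FiniteDimensional ℝ E]
  {M : Type*} [TopologicalSpace M] [ChartedSpace E M] [IsManifold 𝓘(ℝ, E) ∞ M]
  [RiemannianBundle (fun x : N ↦ TangentSpace 𝓘(ℝ, F) x)]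
  [IsContMDiffRiemannianBundle 𝓘(ℝ, F) ∞ F (fun x : N ↦ TangentSpace 𝓘(ℝ, F) x)]
  [RiemannianBundle (fun x : M ↦ TangentSpace 𝓘(ℝ, E) x)]
  [IsContMDiffRiemannianBundle 𝓘(ℝ, E) ∞ E (fun x : M ↦ TangentSpace 𝓘(ℝ, E) x)]
  {f : N → M} {S : StatisticalStructure F N} {T : StatisticalStructure E M}
  {Q : AlmostQuaternionStructure E M} {c : ℝ} {p : N} {U : Set M}
  {J : Fin 3 → Π x : M, TangentSpace 𝓘(ℝ, E) x →L[ℝ] TangentSpace 𝓘(ℝ, E) x}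

/-- By the adjoint in `tangentialPart`, the numbers `g(e_a, J_α e_b)` are the matrix entries of
`P_α`. -/
lemma inner_tangentialPart
    (A : TangentSpace 𝓘(ℝ, E) (f p) →L[ℝ] TangentSpace 𝓘(ℝ, E) (f p))
    (u v : TangentSpace 𝓘(ℝ, F) p) :
    inner ℝ u (tangentialPart f p A v)
      = inner ℝ (mfderiv 𝓘(ℝ, F) 𝓘(ℝ, E) f p u) (A (mfderiv 𝓘(ℝ, F) 𝓘(ℝ, E) f p v)) := by
  rw [tangentialPart, LinearMap.comp_apply, LinearMap.adjoint_inner_right]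
  rfl

variable {n : ℕ} (e : OrthonormalBasis (Fin n) ℝ (TangentSpace 𝓘(ℝ, F) p))

lemma sum_orderedPairs_tangentialPart
    (A : TangentSpace 𝓘(ℝ, E) (f p) →L[ℝ] TangentSpace 𝓘(ℝ, E) (f p)) :
    letI d := mfderiv 𝓘(ℝ, F) 𝓘(ℝ, E) f p
    letI j : Fin n → Fin n → ℝ := fun a b ↦ inner ℝ (d (e a)) (A (d (e b)))
    letI P := tangentialPart f p A
    ∑ q ∈ orderedPairs n, (j q.1 q.1 * j q.2 q.2 - 2 * (j q.1 q.2 * j q.2 q.1)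
        + (1 / 2) * j q.1 q.2 ^ 2 + (1 / 2) * j q.2 q.1 ^ 2)
      = (1 / 2) * (LinearMap.trace ℝ _ P) ^ 2 + (1 / 2) * ∑ i, ‖P (e i)‖ ^ 2
        - LinearMap.trace ℝ _ (P ∘ₗ P) := by
  dsimp only
  rw [trace_comp_eq_sum_inner e, LinearMap.trace_eq_sum_inner _ e]
  simp only [← e.sum_sq_inner_right, inner_tangentialPart]
  exact sum_orderedPairs_bilin fun a b ↦ inner ℝ (mfderiv 𝓘(ℝ, F) 𝓘(ℝ, E) f p (e a))
    (A (mfderiv 𝓘(ℝ, F) 𝓘(ℝ, E) f p (e b)))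

variable [T2Space N] [T2Space M]

/-- The difference of the scalar curvatures `τ - τ°`, without the contribution of the plane spanned
by `e a` and `e b`. -/
theorem scalarK_sub_scalarLC_sub (hf : IsStatisticalSubmanifold f S T)
    (hT : IsQuaternionKaehlerLike T Q c) (hU : f p ∈ U) (hJ : IsCanonicalBasis E M Q.Λ U J)
    {a b : Fin n} (hab : a < b) :
    letI d := mfderiv 𝓘(ℝ, F) 𝓘(ℝ, E) f p
    letI j : Fin 3 → Fin n → Fin n → ℝ := fun α a b ↦ inner ℝ (d (e a)) (J α (f p) (d (e b)))
    letI P := fun α ↦ tangentialPart f p (J α (f p))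
    letI σ := secondFundamentalForm S.conn T.conn f p
    letI σ' := secondFundamentalForm S.dual T.dual f p
    letI g : Fin n → Fin n → ℝ := fun i j ↦
      (1 / 2) * (inner ℝ (σ (e i) (e j)) (σ (e i) (e j))
        - inner ℝ (σ (e i) (e i)) (σ (e j) (e j)))
    letI g' : Fin n → Fin n → ℝ := fun i j ↦
      (1 / 2) * (inner ℝ (σ' (e i) (e j)) (σ' (e i) (e j))
        - inner ℝ (σ' (e i) (e i)) (σ' (e j) (e j)))
    (S.scalarK p e - S.scalarLC p e)
        - (S.sectionalK p (e a) (e b) - S.sectionalLC p (e a) (e b))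
      = c / 8 * (n - 2) * (n + 1)
        + 2 * T.sectionalLC (f p) (d (e a)) (d (e b)) - 2 * T.scalarLC (f p) (fun i ↦ d (e i))
        + c / 4 * ∑ α, ((1 / 2) * (LinearMap.trace ℝ _ (P α)) ^ 2 + (1 / 2) * ∑ i, ‖P α (e i)‖ ^ 2
            - LinearMap.trace ℝ _ (P α ∘ₗ P α))
        - c / 4 * ∑ α, ((1 / 2) * j α a b ^ 2 + (1 / 2) * j α b a ^ 2
            + j α a a * j α b b - 2 * j α a b * j α b a)
        + (∑ q ∈ orderedPairs n, g q.1 q.2 - g a b)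
        + (∑ q ∈ orderedPairs n, g' q.1 q.2 - g' a b) := by
  have h1 : ∀ i, inner ℝ (e i) (e i) = (1 : ℝ) := fun i ↦ by simp
  have key := fun (q : Fin n × Fin n) (hq : q.1 < q.2) ↦
    sectionalK_sub_sectionalLC hf hT hU hJ (h1 q.1) (h1 q.2) (e.inner_eq_zero hq.ne)
  have hsum := Finset.sum_congr rfl fun q hq ↦ key q (mem_orderedPairs.1 hq)
  have hab' := key (a, b) hab
  dsimp only at hab' hsum ⊢
  rw [hab']
  have hP := fun α ↦ sum_orderedPairs_tangentialPart e (J α (f p))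
  have hcard := two_mul_card_orderedPairs n
  dsimp only at hP
  simp only [← hP]
  rw [StatisticalStructure.scalarK, StatisticalStructure.scalarLC, StatisticalStructure.scalarLC,
    sum_sum_ite_lt fun i k ↦ S.sectionalK p (e i) (e k),
    sum_sum_ite_lt fun i k ↦ S.sectionalLC p (e i) (e k),
    sum_sum_ite_lt fun i k ↦ T.sectionalLC (f p) (mfderiv 𝓘(ℝ, F) 𝓘(ℝ, E) f p (e i))
      (mfderiv 𝓘(ℝ, F) 𝓘(ℝ, E) f p (e k)),
    ← Finset.sum_sub_distrib, hsum, Finset.sum_comm (s := Finset.univ)]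
  simp only [Finset.sum_add_distrib, Finset.sum_sub_distrib, ← Finset.mul_sum, mul_add,
    Fin.sum_univ_three] at hcard ⊢
  -- The constant terms come from `n(n - 1)/2 - 1 = (n - 2)(n + 1)/2` pairs, the plane `π` being
  -- left out.
  linear_combination c / 8 * hcard

end ScalarCurvature

end QuaternionStatistical

end

/-! ### The inequality and its equality case. -/

theorem mainTheorem1 (m n : ℕ) (hn : 2 ≤ n)
    {N : Type*} [TopologicalSpace N] [T2Space N]
    [ChartedSpace (EuclideanSpace ℝ (Fin n)) N] [IsManifold (𝓡 n) ∞ N]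
    [RiemannianBundle (fun x : N ↦ TangentSpace (𝓡 n) x)]
    [IsContMDiffRiemannianBundle (𝓡 n) ∞ (EuclideanSpace ℝ (Fin n))
      (fun x : N ↦ TangentSpace (𝓡 n) x)]
    {M : Type*} [TopologicalSpace M] [T2Space M]
    [ChartedSpace (EuclideanSpace ℝ (Fin (4 * m))) M] [IsManifold (𝓡 (4 * m)) ∞ M]
    [RiemannianBundle (fun x : M ↦ TangentSpace (𝓡 (4 * m)) x)]
    [IsContMDiffRiemannianBundle (𝓡 (4 * m)) ∞ (EuclideanSpace ℝ (Fin (4 * m)))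
      (fun x : M ↦ TangentSpace (𝓡 (4 * m)) x)]
    -- the ambient quaternion Kaehler-like statistical manifold
    (T : StatisticalStructure (EuclideanSpace ℝ (Fin (4 * m))) M)
    (Q : AlmostQuaternionStructure (EuclideanSpace ℝ (Fin (4 * m))) M)
    (c : ℝ) (hT : IsQuaternionKaehlerLike T Q c)
    -- the statistical submanifold
    (S : StatisticalStructure (EuclideanSpace ℝ (Fin n)) N)
    (f : N → M) (hf : IsStatisticalSubmanifold f S T)
    -- a point, a canonical basis near it, and orthonormal tangent and normal frames
    (p : N) (U : Set M) (hU : f p ∈ U)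
    (J : Fin 3 → Π x : M, TangentSpace (𝓡 (4 * m)) x →L[ℝ] TangentSpace (𝓡 (4 * m)) x)
    (hJ : IsCanonicalBasis (EuclideanSpace ℝ (Fin (4 * m))) M Q.Λ U J)
    (e : OrthonormalBasis (Fin n) ℝ (TangentSpace (𝓡 n) p))
    (ξ : OrthonormalBasis (Fin (4 * m - n)) ℝ
      (normalSpace (EuclideanSpace ℝ (Fin n)) (EuclideanSpace ℝ (Fin (4 * m))) f p)) :
    -- the plane `π` is spanned by `e₁ = e i₁` and `e₂ = e i₂`
    let i₁ : Fin n := ⟨0, by omega⟩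
    let i₂ : Fin n := ⟨1, by omega⟩
    let d : TangentSpace (𝓡 n) p →L[ℝ] TangentSpace (𝓡 (4 * m)) (f p) :=
      mfderiv (𝓡 n) (𝓡 (4 * m)) f p
    let σ := secondFundamentalForm S.conn T.conn f p
    let σ' := secondFundamentalForm S.dual T.dual f p
    let H := meanCurvature σ e
    let H' := meanCurvature σ' e
    let P : Fin 3 → TangentSpace (𝓡 n) p →ₗ[ℝ] TangentSpace (𝓡 n) p :=
      fun α ↦ tangentialPart f p (J α (f p))
    -- `j α a b = g(e_a, J_α e_b)`
    let j : Fin 3 → Fin n → Fin n → ℝ := fun α a b ↦ inner ℝ (d (e a)) (J α (f p) (d (e b)))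
    let lhs : ℝ := (S.scalarK p e - S.scalarLC p e)
      - (S.sectionalK p (e i₁) (e i₂) - S.sectionalLC p (e i₁) (e i₂))
    let rhsReal : ℝ := c / 8 * (n - 2) * (n + 1)
      - (n : ℝ) ^ 2 * (n - 2) / (4 * (n - 1)) * (‖H‖ ^ 2 + ‖H'‖ ^ 2)
      + 2 * T.sectionalLC (f p) (d (e i₁)) (d (e i₂)) - 2 * T.scalarLC (f p) (fun i ↦ d (e i))
    let rhsHol : ℝ := rhsReal
      + c / 4 * ∑ α, ((1 / 2) * (LinearMap.trace ℝ _ (P α)) ^ 2 + (1 / 2) * ∑ i, ‖P α (e i)‖ ^ 2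
          - LinearMap.trace ℝ _ (P α ∘ₗ P α))
      - c / 4 * ∑ α, ((1 / 2) * j α i₁ i₂ ^ 2 + (1 / 2) * j α i₂ i₁ ^ 2
          + j α i₁ i₁ * j α i₂ i₂ - 2 * j α i₁ i₂ * j α i₂ i₁)
    let equalityCase : Prop :=
      ∀ γ : Fin (4 * m - n),
        (∀ k : Fin n, 2 ≤ (k : ℕ) →
          inner ℝ (σ (e i₁) (e i₁)) (ξ γ : TangentSpace (𝓡 (4 * m)) (f p))
              + inner ℝ (σ (e i₂) (e i₂)) (ξ γ : TangentSpace (𝓡 (4 * m)) (f p))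
            = inner ℝ (σ (e k) (e k)) (ξ γ : TangentSpace (𝓡 (4 * m)) (f p))) ∧
        (∀ k : Fin n, 2 ≤ (k : ℕ) →
          inner ℝ (σ' (e i₁) (e i₁)) (ξ γ : TangentSpace (𝓡 (4 * m)) (f p))
              + inner ℝ (σ' (e i₂) (e i₂)) (ξ γ : TangentSpace (𝓡 (4 * m)) (f p))
            = inner ℝ (σ' (e k) (e k)) (ξ γ : TangentSpace (𝓡 (4 * m)) (f p))) ∧
        (∀ k l : Fin n, k ≠ l → ¬ (k = i₁ ∧ l = i₂) → ¬ (k = i₂ ∧ l = i₁) →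
          inner ℝ (σ (e k) (e l)) (ξ γ : TangentSpace (𝓡 (4 * m)) (f p)) = 0 ∧
          inner ℝ (σ' (e k) (e l)) (ξ γ : TangentSpace (𝓡 (4 * m)) (f p)) = 0)
    (IsHolomorphic (F := EuclideanSpace ℝ (Fin n)) (E := EuclideanSpace ℝ (Fin (4 * m))) f Q →
      lhs ≥ rhsHol ∧ (lhs = rhsHol ↔ equalityCase)) ∧
    (IsTotallyReal (F := EuclideanSpace ℝ (Fin n)) (E := EuclideanSpace ℝ (Fin (4 * m))) f Q →
      lhs ≥ rhsReal ∧ (lhs = rhsReal ↔ equalityCase)) := by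
  intro i₁ i₂ d σ σ' H H' P j lhs rhsReal rhsHol equalityCase
  have hlt : i₁ < i₂ := Nat.zero_lt_one
  obtain ⟨h1, h2⟩ := chen_inequality_vector hn (i₁ := i₁) (i₂ := i₂) rfl rfl σ e
    (V := normalSpace (EuclideanSpace ℝ (Fin n)) (EuclideanSpace ℝ (Fin (4 * m))) f p)
    (IsTangentialPart.secondFundamentalForm_mem hf.tangential_conn)
    (secondFundamentalForm_comm S.torsion_conn T.torsion_conn hf.smooth) ξ
  obtain ⟨h1', h2'⟩ := chen_inequality_vector hn (i₁ := i₁) (i₂ := i₂) rfl rfl σ' e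
    (V := normalSpace (EuclideanSpace ℝ (Fin n)) (EuclideanSpace ℝ (Fin (4 * m))) f p)
    (IsTangentialPart.secondFundamentalForm_mem hf.tangential_dual)
    (secondFundamentalForm_comm S.torsion_dual T.torsion_dual hf.smooth) ξ
  set δ : ℝ := _ * ‖meanCurvature σ e‖ ^ 2 + _ with hδ
  set δ' : ℝ := _ * ‖meanCurvature σ' e‖ ^ 2 + _ with hδ'
  -- The gap to the bound is the sum of the Chen defects of `σ` and `σ*`. Both are non-negative, so
  -- equality means that both vanish.
  have hl : lhs = rhsHol + δ + δ' := by
    refine (scalarK_sub_scalarLC_sub e hf hT hU hJ hlt).trans ?_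
    simp only [rhsHol, rhsReal, hδ, hδ']
    ring
  have heq : equalityCase ↔ δ = 0 ∧ δ' = 0 := by
    rw [h2, h2']
    refine ⟨fun h ↦ ⟨fun γ ↦ ⟨(h γ).1, fun k l a b c ↦ ((h γ).2.2 k l a b c).1⟩,
      fun γ ↦ ⟨(h γ).2.1, fun k l a b c ↦ ((h γ).2.2 k l a b c).2⟩⟩,
      fun h γ ↦ ⟨(h.1 γ).1, (h.2 γ).1, fun k l a b c ↦
        ⟨(h.1 γ).2 k l a b c, (h.2 γ).2 k l a b c⟩⟩⟩
  have hhol : lhs ≥ rhsHol ∧ (lhs = rhsHol ↔ equalityCase) := by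
    rw [heq, hl]
    exact ⟨by linarith, fun h ↦ ⟨by linarith, by linarith⟩, fun h ↦ by rw [h.1, h.2]; ring⟩
  refine ⟨fun _ ↦ hhol, fun hreal ↦ ?_⟩
  -- Each `J_α` lies in `Λ`, so it maps tangent vectors to normal ones; every `J`-term of the bound
  -- is then zero.
  have hj : ∀ α u v, inner ℝ (d u) (J α (f p) (d v)) = (0 : ℝ) := fun α u v ↦ by
    rw [real_inner_comm]
    refine inner_mfderiv_of_mem_normalSpace (hreal p _ ?_ v) u
    rw [hJ.span _ hU]
    exact Submodule.subset_span ⟨α, rfl⟩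
  have hP : ∀ α, P α = 0 := fun α ↦ LinearMap.ext fun v ↦ ext_inner_left ℝ fun u ↦ by
    rw [LinearMap.zero_apply, inner_zero_right]
    exact (inner_tangentialPart _ u v).trans (hj α u v)
  have hr : rhsHol = rhsReal := by
    simp [rhsHol, hP, j, hj]
  rwa [hr] at hhol
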